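/- \textbf{Setting.} Let $G=\mathbf H\rtimes_\varphi\mathbf A$ be a connected, simply connected, non-degenerate, split abelian-by-abelian solvable Lie group: $\mathbf H,\mathbf A$ are finite-dimensional real vector spaces, $\varphi(\mathbf t)=\exp(\mathrm{ad}(\mathbf t))$ with $\mathrm{ad}:\mathbf A\to\mathrm{End}(\mathbf H)$ linear with commuting values, and $\mathbf H=\bigoplus_{\alpha\in\triangle}V_\alpha$, where $V_\alpha=\{x:\forall \mathbf t\,\exists n\ (\mathrm{ad}(\mathbf t)-\alpha(\mathbf t)\mathrm{Id})^n x=0\}\neq 0$ and the finite set $\triangle\subset\mathbf A^*\setminus\{0\}$ of roots spans $\mathbf A^*$. Fix inner products on $\mathbf A$ and on $\mathbf H$ for which the $V_\alpha$ are mutually orthogonal, and let $d$ be the distance of the left-invariant Riemannian metric $|d\mathbf t|^2+|\varphi(-\mathbf t)\,d\mathbf x|^2$ on $G$. Let $\pi_A(\mathbf x,\mathbf t)=\mathbf t$. A \emph{straight geodesic segment} is a set $p\,\overline{A'B'}$ with $p\in G$ and $\overline{A'B'}\subset\mathbf A$ a line segment. The \emph{walls based at} $p$ are $p\bigcup_{\Xi\in\triangle}\ker\Xi$.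 The \emph{$(\eta,c)$-linear neighbourhood} of a set $X$ with respect to $x_0$ is the union of the closed balls of radius $\eta\, d(x,x_0)+c$ about the points $x\in X$. A $(\kappa,C)$ quasi-geodesic is a continuous $\lambda:[0,L]\to G$ with $\frac1\kappa|s-t|-C\le d(\lambda(s),\lambda(t))\le\kappa|s-t|+C$ for all $s,t$. For $\lambda:[0,L]\to G$ write $D=d(\lambda(0),\lambda(L))$ and $|\pi_A(\lambda)|=|\pi_A\lambda(0)-\pi_A\lambda(L)|$. Given a constant $\hbar$, a segment $\overline{AB}\subset\mathbf A$ and $0\le\epsilon<1$ with $d_H(\pi_A(\lambda),\overline{AB})\le\epsilon|\pi_A(\lambda)|$, let $h_{\overline{AB}}$ be the closest point projection to $\overline{AB}$. Then $\lambda$ is \emph{$\delta$-monotone} if $2\hbar\epsilon\le\delta<1$ and \[h_{\overline{AB}}(\pi_A\lambda(t_1))=h_{\overline{AB}}(\pi_A\lambda(t_2))\ \Rightarrow\ d(\lambda(t_1),\lambda(t_2))\le\delta D,\] and \emph{$(\eta,C_1)$ weakly monotone} if $2\epsilon\hbar(2\kappa)^2\le\eta<1$ and, for $t_1>t_2$,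 \[h_{\overline{AB}}(\pi_A\lambda(t_1))=h_{\overline{AB}}(\pi_A\lambda(t_2))\ \Rightarrow\ d(\lambda(t_1),\lambda(t_2))\le\eta\, d(\lambda(t_1),\lambda(0))+C_1 .\] \textbf{Proposition.} For all $G$ (with its metric), $\kappa\ge1$ and $C\ge0$ there is a constant $\hbar\ge1$, depending only on these, such that the following holds. Let $\lambda:[0,L]\to G$ be a $(\kappa,C)$ quasi-geodesic, let $0<\delta<1$ with $\delta D\ge3$, let $\overline{AB}\subset\mathbf A$ be a segment and $\epsilon$ a real number, and suppose that for some $t_0\in[0,L]$ and all $t\in[t_0,L]$ the point $\pi_A(\lambda(t))$ lies outside the $\left(\frac{3}{\delta D},C\right)$-linear neighbourhood in $\mathbf A$, with respect to $\pi_A(\lambda(0))$, of the $\pi_A$-image of the walls based at $\lambda(0)$. \begin{enumerate} \item If $\lambda$ is $\delta$-monotone with respect to $\hbar,\epsilon,\overline{AB}$, then there is a straight geodesic segment whose Hausdorff distance from $\lambda([0,L])$ is at most \[2|\triangle|\left(\hbar\sqrt{\delta^2+4\epsilon^2}\,(|\overline{AB}|+1)+\delta D\right)\] and also at most $\hbar\,\delta\,(L+1)$;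 in particular it is $O(\delta L)$ if $L\ge1$. \item Let $C_1\ge0$ and $\hbar\eta\le1$. If $\lambda$ is $(\eta,C_1)$ weakly monotone with respect to $\hbar,\epsilon,\overline{AB}$, put $c=|\triangle|\left(\hbar\sqrt{\delta^2+4\epsilon^2}\,(|\overline{AB}|+1)+C_1\right)$. Then there are a straight geodesic segment $\gamma$ and a point $x_0\in\gamma$ with $d(\lambda(0),x_0)\le c$ such that $\lambda([0,L])$ is contained in the $(|\triangle|\eta,\,c)$-linear neighbourhood of $\gamma$ with respect to $x_0$. \end{enumerate} -/

import Mathlib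

open Set

noncomputable section

/-- The simultaneous generalized eigenspace
`{x : ∀ t, ∃ n, (ad t - α(t) Id)^n x = 0}` of a linear family of endomorphisms. -/
def rootSpace {H A : Type*} [NormedAddCommGroup H] [InnerProductSpace ℝ H]
    [NormedAddCommGroup A] [InnerProductSpace ℝ A]
    (ad : A →ₗ[ℝ] (H →L[ℝ] H)) (α : Module.Dual ℝ A) : Submodule ℝ H :=
  ⨅ t : A, Module.End.maxGenEigenspace ((ad t : H →L[ℝ] H) : H →ₗ[ℝ] H) (α t)

/-- A connected, simply connected, non-degenerate, split abelian-by-abelian solvable Lie group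
`G = H ⋊ A`, given by its Lie algebra `𝔥 ⋊ 𝔞` with `𝔥`, `𝔞` abelian, together with a
Euclidean structure on `𝔥 ⊕ 𝔞` for which `𝔥`, `𝔞` and the distinct root spaces are orthogonal. -/
structure SplitAbelianByAbelian (H A : Type*)
    [NormedAddCommGroup H] [InnerProductSpace ℝ H]
    [NormedAddCommGroup A] [InnerProductSpace ℝ A] where
  /-- The adjoint action of `𝔞` on `𝔥`. -/
  ad : A →ₗ[ℝ] (H →L[ℝ] H)
  ad_commute : ∀ s t : A, Commute (ad s) (ad t)
  /-- The set `△` of roots. -/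
  roots : Finset (Module.Dual ℝ A)
  mem_roots : ∀ α : Module.Dual ℝ A, α ∈ roots ↔ rootSpace ad α ≠ ⊥
  /-- All roots are non-zero, i.e. `𝔞` is its own generalized `0`-eigenspace. -/
  zero_notMem_roots : (0 : Module.Dual ℝ A) ∉ roots
  /-- `𝔥` is the sum of the root spaces. -/
  iSup_rootSpace : (⨆ α ∈ roots, rootSpace ad α) = ⊤
  /-- Non-degeneracy. -/
  span_roots : Submodule.span ℝ (roots : Set (Module.Dual ℝ A)) = ⊤
  rootSpace_orthogonal : ∀ α ∈ roots, ∀ β ∈ roots, α ≠ β → rootSpace ad α ⟂ rootSpace ad β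

namespace SplitAbelianByAbelian

variable {H A : Type*} [NormedAddCommGroup H] [InnerProductSpace ℝ H]
  [NormedAddCommGroup A] [InnerProductSpace ℝ A]

/-- The action `φ(t) = exp (ad t)` of `A` on `H`. -/
def phi (S : SplitAbelianByAbelian H A) (t : A) : H →L[ℝ] H :=
  NormedSpace.exp (S.ad t)

theorem phi_zero (S : SplitAbelianByAbelian H A) : S.phi 0 = 1 := by
  simp [phi]

theorem phi_add [FiniteDimensional ℝ H] (S : SplitAbelianByAbelian H A) (s t : A) :
    S.phi (s + t) = S.phi s * S.phi t := by
  have : CompleteSpace H := FiniteDimensional.complete ℝ H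
  let _ : NormedAlgebra ℚ (H →L[ℝ] H) := NormedAlgebra.restrictScalars ℚ ℝ (H →L[ℝ] H)
  simp only [phi, map_add]
  exact NormedSpace.exp_add_of_commute (S.ad_commute s t)

/-- The points `(x, t)` of `G = H ⋊ A`; the second coordinate is the projection `π_A`. -/
@[ext]
structure Point (S : SplitAbelianByAbelian H A) where
  hor : H
  ver : A

/-- The group law `(x, s) (y, t) = (x + φ(s) y, s + t)`. -/
instance [FiniteDimensional ℝ H] (S : SplitAbelianByAbelian H A) : Group S.Point where
  mul p q := ⟨p.hor + S.phi p.ver q.hor, p.ver + q.ver⟩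
  one := ⟨0, 0⟩
  inv p := ⟨-(S.phi (-p.ver) p.hor), -p.ver⟩
  mul_assoc p q r := by
    apply Point.ext
    · change p.hor + S.phi p.ver q.hor + S.phi (p.ver + q.ver) r.hor
        = p.hor + S.phi p.ver (q.hor + S.phi q.ver r.hor)
      rw [phi_add, map_add, add_assoc]
      rfl
    · exact add_assoc _ _ _
  one_mul p := by
    apply Point.ext
    · change 0 + S.phi 0 p.hor = p.hor
      rw [phi_zero, zero_add]
      rfl
    · exact zero_add _
  mul_one p := by
    apply Point.ext
    · change p.hor + S.phi p.ver 0 = p.hor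
      rw [map_zero, add_zero]
    · exact add_zero _
  inv_mul_cancel p := by
    apply Point.ext
    · change -(S.phi (-p.ver) p.hor) + S.phi (-p.ver) p.hor = 0
      exact neg_add_cancel _
    · exact neg_add_cancel _

/-- The inclusion of the subgroup `A`. -/
def ofA (S : SplitAbelianByAbelian H A) (t : A) : S.Point := ⟨0, t⟩

/-- The length of the `C¹` curve `s ↦ (x(s), t(s))`, `0 ≤ s ≤ 1`, for the left-invariant
Riemannian metric `|dt|² + |φ(-t) dx|²`. -/
def curveLength (S : SplitAbelianByAbelian H A) (x : ℝ → H) (t : ℝ → A) : ℝ :=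
  ∫ s in (0 : ℝ)..1, Real.sqrt (‖deriv t s‖ ^ 2 + ‖S.phi (-(t s)) (deriv x s)‖ ^ 2)

/-- The left-invariant Riemannian distance on `G`: the infimum of the lengths of `C¹` curves. -/
def rdist (S : SplitAbelianByAbelian H A) (p q : S.Point) : ℝ :=
  sInf {l : ℝ | ∃ (x : ℝ → H) (t : ℝ → A), ContDiff ℝ 1 x ∧ ContDiff ℝ 1 t ∧
    x 0 = p.hor ∧ t 0 = p.ver ∧ x 1 = q.hor ∧ t 1 = q.ver ∧ l = S.curveLength x t}

/-- The walls based at `p`: the set `p ⋃_Ξ ker Ξ`, the union being over the roots. -/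
def walls [FiniteDimensional ℝ H] (S : SplitAbelianByAbelian H A) (p : S.Point) : Set S.Point :=
  {y | ∃ α ∈ S.roots, ∃ t : A, α t = 0 ∧ y = p * S.ofA t}

/-- The geodesic segment `p · [a, b]` with `[a, b]` a line segment in `A`. -/
def geodSegment [FiniteDimensional ℝ H] (S : SplitAbelianByAbelian H A) (p : S.Point)
    (a b : A) : Set S.Point :=
  (fun t => p * S.ofA t) '' segment ℝ a b

/-- `lam` restricted to `[0, L]` is a (continuous) `(κ, C)` quasi-geodesic. -/
def IsQuasiGeodesic (S : SplitAbelianByAbelian H A) (κ C L : ℝ) (lam : ℝ → S.Point) : Prop :=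
  ContinuousOn (fun t => (lam t).hor) (Icc 0 L) ∧
  ContinuousOn (fun t => (lam t).ver) (Icc 0 L) ∧
  ∀ s ∈ Icc 0 L, ∀ t ∈ Icc 0 L,
    |s - t| / κ - C ≤ S.rdist (lam s) (lam t) ∧ S.rdist (lam s) (lam t) ≤ κ * |s - t| + C

/-- The `A`-projection of `lam` is within Hausdorff distance `ε |π_A(lam)|` of the line segment
`[a, b]`, where `|π_A(lam)|` is the distance between the end points of `π_A(lam)`. -/
def NearSegment (S : SplitAbelianByAbelian H A) (ε L : ℝ) (a b : A) (lam : ℝ → S.Point) : Prop :=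
  0 ≤ ε ∧ ε < 1 ∧
  Metric.hausdorffDist ((fun t => (lam t).ver) '' Icc 0 L) (segment ℝ a b)
    ≤ ε * dist (lam 0).ver (lam L).ver

/-- The points `v`, `w` of `A` have the same closest point on the segment `[a, b]`. -/
def SameProj (a b v w : A) : Prop :=
  ∃ q ∈ segment ℝ a b,
    dist v q = Metric.infDist v (segment ℝ a b) ∧ dist w q = Metric.infDist w (segment ℝ a b)

/-- `δ`-monotonicity along `[a, b]`; the requirement `δ ≫ 2ħε` is `2ħε ≤ δ`, where `ħ` is a
constant that may be taken large. -/
def IsMonotone (S : SplitAbelianByAbelian H A) (hbar ε δ L : ℝ) (a b : A)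
    (lam : ℝ → S.Point) : Prop :=
  S.NearSegment ε L a b lam ∧ 2 * hbar * ε ≤ δ ∧ δ < 1 ∧
  ∀ t₁ ∈ Icc 0 L, ∀ t₂ ∈ Icc 0 L, SameProj a b (lam t₁).ver (lam t₂).ver →
    S.rdist (lam t₁) (lam t₂) ≤ δ * S.rdist (lam 0) (lam L)

/-- `(ν, C₁)` weak monotonicity along `[a, b]`; the requirement `ν ≫ 2εħ(2κ)²` is
`2εħ(2κ)² ≤ ν`, where `ħ` is a constant that may be taken large. -/
def IsWeaklyMonotone (S : SplitAbelianByAbelian H A) (κ hbar ε ν C₁ L : ℝ) (a b : A)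
    (lam : ℝ → S.Point) : Prop :=
  S.NearSegment ε L a b lam ∧ 2 * ε * hbar * (2 * κ) ^ 2 ≤ ν ∧ ν < 1 ∧
  ∀ t₁ ∈ Icc 0 L, ∀ t₂ ∈ Icc 0 L, t₂ < t₁ → SameProj a b (lam t₁).ver (lam t₂).ver →
    S.rdist (lam t₁) (lam t₂) ≤ ν * S.rdist (lam t₁) (lam 0) + C₁

end SplitAbelianByAbelian

/-- The `(η, c)`-linear neighbourhood of `X` with respect to `x₀`, for the distance `d`:
the union of the balls of radius `η d(x, x₀) + c` about the points `x` of `X`. -/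
def linearNbhd {Y : Type*} (d : Y → Y → ℝ) (X : Set Y) (x₀ : Y) (η c : ℝ) : Set Y :=
  {y | ∃ x ∈ X, d y x ≤ η * d x x₀ + c}

/-- `X` and `Z` are within Hausdorff distance `r` of each other, for the distance `d`. -/
def HausdorffWithin {Y : Type*} (d : Y → Y → ℝ) (r : ℝ) (X Z : Set Y) : Prop :=
  (∀ x ∈ X, ∃ z ∈ Z, d x z ≤ r) ∧ (∀ z ∈ Z, ∃ x ∈ X, d x z ≤ r)

end

/-!
Let `α` be a root. Seen from a point `p`, the displacement of another point along the root space of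
`α` becomes, in the frame at height `p.ver`, a vector whose norm is exponential in the distance;
conversely a horizontal vector of norm `r` costs a distance of about `2 log r / ‖α‖`
(`exists_norm_phi_rootProj_le`, `exists_rdist_translate_le`). A straight segment is a set of points
with one fixed horizontal coordinate. So the task is to find a horizontal coordinate `y` such that,
for every `t`, the displacement from `λ t` to `y`, measured in the frame of `λ t`, is small in every
root space.

A quasi-geodesic whose projection to `A` stays in a bounded set is short
(`exists_abs_sub_le_of_ver_bounded`), because its horizontal displacement, measured in a fixed
frame, grows linearly with time, hence the distance only logarithmically. The hypothesis on the
walls says that every root has, along the segment which the projection follows, a slope that is not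
small compared with the deviation allowed by monotonicity (`exists_followsLine`). Hence each root is
essentially monotone along the path. The horizontal displacement that a root collects while it is
below a given level decays exponentially with the depth, so that its sum is controlled in the frame
at this level (`exists_displacement_below_le`), and `y` can be taken, root by root, to be the
coordinate of the path at the time when that root is lowest. Any other point of the path is compared
with `y` through the last point at its level before this lowest point, which is close to it by weak
monotonicity (`exists_displacement_le`, `exists_horizontal_coordinate`).

The sharp factor `|△|` in front of `η` leaves no room for logarithmic errors, nor for replacing the
distance to `λ 0` by the distance to a point of the segment. The room comes from a saving in the
passage from root spaces to `H`: separate excursions along the gradients of the roots would cost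
the full factor, but two of them whose directions are not opposite can be joined along a triangle,
and if all directions are opposite, `A` is a line and the last excursion need not return
(`exists_rdist_translate_le`). The factor thus gained absorbs these errors (`le_of_le_slack`).
A `δ`-monotone path is weakly monotone with `η = 0` and `C₁ = δ D`.
-/

namespace SplitAbelianByAbelian

variable {H A : Type*} [NormedAddCommGroup H] [InnerProductSpace ℝ H]
  [NormedAddCommGroup A] [InnerProductSpace ℝ A]

/-! ### The Riemannian distance -/

theorem deriv_comp_add_comp_sub {V : Type*} [NormedAddCommGroup V] [NormedSpace ℝ V]
    {y₁ y₂ : ℝ → V} {k₁ k₂ : ℝ → ℝ} (c : V) (h₁ : ContDiff ℝ 1 y₁) (h₂ : ContDiff ℝ 1 y₂)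
    (hk₁ : ContDiff ℝ 1 k₁) (hk₂ : ContDiff ℝ 1 k₂) (s : ℝ) :
    deriv (fun s => y₁ (k₁ s) + y₂ (k₂ s) - c) s =
      deriv k₁ s • deriv y₁ (k₁ s) + deriv k₂ s • deriv y₂ (k₂ s) := by
  have a₁ := (h₁.differentiable one_ne_zero (k₁ s)).hasDerivAt.scomp s
    (hk₁.differentiable one_ne_zero s).hasDerivAt
  have a₂ := (h₂.differentiable one_ne_zero (k₂ s)).hasDerivAt.scomp s
    (hk₂.differentiable one_ne_zero s).hasDerivAt
  exact ((a₁.add a₂).sub_const c).deriv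

/-- The speed at time `s` of the curve `(x, t)`. -/
noncomputable def speed (S : SplitAbelianByAbelian H A) (x : ℝ → H) (t : ℝ → A) (s : ℝ) : ℝ :=
  Real.sqrt (‖deriv t s‖ ^ 2 + ‖S.phi (-(t s)) (deriv x s)‖ ^ 2)

theorem norm_deriv_ver_le_speed (S : SplitAbelianByAbelian H A) (x : ℝ → H) (t : ℝ → A) (s : ℝ) :
    ‖deriv t s‖ ≤ S.speed x t s :=
  Real.le_sqrt_of_sq_le (by nlinarith [sq_nonneg ‖S.phi (-(t s)) (deriv x s)‖])

theorem norm_deriv_hor_le_speed (S : SplitAbelianByAbelian H A) (x : ℝ → H) (t : ℝ → A) (s : ℝ) :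
    ‖S.phi (-(t s)) (deriv x s)‖ ≤ S.speed x t s :=
  Real.le_sqrt_of_sq_le (by nlinarith [sq_nonneg ‖deriv t s‖])

theorem curveLength_eq (S : SplitAbelianByAbelian H A) (x : ℝ → H) (t : ℝ → A) :
    S.curveLength x t = ∫ s in (0 : ℝ)..1, S.speed x t s := rfl

theorem curveLength_nonneg (S : SplitAbelianByAbelian H A) (x : ℝ → H) (t : ℝ → A) :
    0 ≤ S.curveLength x t :=
  intervalIntegral.integral_nonneg zero_le_one fun _ _ => Real.sqrt_nonneg _

theorem rdist_le_curveLength (S : SplitAbelianByAbelian H A) {p q : S.Point} {x : ℝ → H} {t : ℝ → A}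
    (hx : ContDiff ℝ 1 x) (ht : ContDiff ℝ 1 t) (hx0 : x 0 = p.hor) (ht0 : t 0 = p.ver)
    (hx1 : x 1 = q.hor) (ht1 : t 1 = q.ver) : S.rdist p q ≤ S.curveLength x t := by
  refine csInf_le ⟨0, ?_⟩ ⟨x, t, hx, ht, hx0, ht0, hx1, ht1, rfl⟩
  rintro _ ⟨x, t, -, -, -, -, -, -, rfl⟩
  exact S.curveLength_nonneg x t

theorem le_rdist (S : SplitAbelianByAbelian H A) {p q : S.Point} {r : ℝ}
    (h : ∀ (x : ℝ → H) (t : ℝ → A), ContDiff ℝ 1 x → ContDiff ℝ 1 t → x 0 = p.hor →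
      t 0 = p.ver → x 1 = q.hor → t 1 = q.ver → r ≤ S.curveLength x t) : r ≤ S.rdist p q := by
  refine le_csInf ?_ ?_
  · refine ⟨_, fun s => p.hor + s • (q.hor - p.hor), fun s => p.ver + s • (q.ver - p.ver),
      contDiff_const.add (contDiff_id.smul contDiff_const),
      contDiff_const.add (contDiff_id.smul contDiff_const), ?_, ?_, ?_, ?_, rfl⟩ <;> simp
  · rintro _ ⟨x, t, hx, ht, h1, h2, h3, h4, rfl⟩
    exact h x t hx ht h1 h2 h3 h4

theorem exists_curveLength_lt (S : SplitAbelianByAbelian H A) {p q : S.Point} {r : ℝ}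
    (h : S.rdist p q < r) : ∃ (x : ℝ → H) (t : ℝ → A), ContDiff ℝ 1 x ∧ ContDiff ℝ 1 t ∧
      x 0 = p.hor ∧ t 0 = p.ver ∧ x 1 = q.hor ∧ t 1 = q.ver ∧ S.curveLength x t < r := by
  by_contra! h'
  exact absurd (S.le_rdist h') (not_le.2 h)

theorem rdist_nonneg (S : SplitAbelianByAbelian H A) (p q : S.Point) : 0 ≤ S.rdist p q :=
  S.le_rdist fun x t _ _ _ _ _ _ => S.curveLength_nonneg x t

theorem rdist_le_rdist_swap (S : SplitAbelianByAbelian H A) (p q : S.Point) :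
    S.rdist p q ≤ S.rdist q p := by
  refine S.le_rdist fun x t hx ht hx0 ht0 hx1 ht1 => ?_
  have hsub : ContDiff ℝ 1 (fun s : ℝ => 1 - s) := contDiff_const.sub contDiff_id
  refine (S.rdist_le_curveLength (hx.comp hsub) (ht.comp hsub) (by simpa using hx1)
    (by simpa using ht1) (by simpa using hx0) (by simpa using ht0)).trans (le_of_eq ?_)
  have h : ∀ s, S.speed (x ∘ fun s => 1 - s) (t ∘ fun s => 1 - s) s = S.speed x t (1 - s) := by
    intro s
    simp only [speed, Function.comp_def, deriv_comp_const_sub, map_neg, norm_neg]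
  rw [curveLength_eq, curveLength_eq]
  simp only [h]
  rw [intervalIntegral.integral_comp_sub_left (S.speed x t) 1]
  simp

theorem rdist_comm (S : SplitAbelianByAbelian H A) (p q : S.Point) : S.rdist p q = S.rdist q p :=
  (S.rdist_le_rdist_swap p q).antisymm (S.rdist_le_rdist_swap q p)

theorem rdist_ver_le (S : SplitAbelianByAbelian H A) (x : H) (v w : A) :
    S.rdist ⟨x, v⟩ ⟨x, w⟩ ≤ ‖w - v‖ := by
  refine (S.rdist_le_curveLength (x := fun _ => x) (t := fun s => v + s • (w - v)) contDiff_const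
    (contDiff_const.add (contDiff_id.smul contDiff_const)) rfl (by simp) rfl (by simp)).trans
    (le_of_eq ?_)
  have h : ∀ s, deriv (fun s : ℝ => v + s • (w - v)) s = w - v := fun s => by
    simpa using (((hasDerivAt_id s).smul_const (w - v)).const_add v).deriv
  simp [curveLength, h]

theorem rdist_hor_le (S : SplitAbelianByAbelian H A) (x y : H) (v : A) :
    S.rdist ⟨x, v⟩ ⟨y, v⟩ ≤ ‖S.phi (-v) (y - x)‖ := by
  refine (S.rdist_le_curveLength (t := fun _ => v) (x := fun s => x + s • (y - x))
    (contDiff_const.add (contDiff_id.smul contDiff_const)) contDiff_const (by simp) rfl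
    (by simp) rfl).trans (le_of_eq ?_)
  have h : ∀ s, deriv (fun s : ℝ => x + s • (y - x)) s = y - x := fun s => by
    simpa using (((hasDerivAt_id s).smul_const (y - x)).const_add x).deriv
  simp [curveLength, h]

theorem rdist_self (S : SplitAbelianByAbelian H A) (p : S.Point) : S.rdist p p = 0 :=
  le_antisymm (by simpa using S.rdist_ver_le p.hor p.ver p.ver) (S.rdist_nonneg p p)

variable [FiniteDimensional ℝ H]

theorem continuous_phi [FiniteDimensional ℝ A] (S : SplitAbelianByAbelian H A) :
    Continuous S.phi := by
  have : CompleteSpace H := FiniteDimensional.complete ℝ H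
  let _ : NormedAlgebra ℚ (H →L[ℝ] H) := NormedAlgebra.restrictScalars ℚ ℝ (H →L[ℝ] H)
  exact NormedSpace.exp_continuous.comp S.ad.continuous_of_finiteDimensional

theorem phi_add_apply (S : SplitAbelianByAbelian H A) (s t : A) (x : H) :
    S.phi (s + t) x = S.phi s (S.phi t x) := by
  rw [phi_add]; rfl

variable [FiniteDimensional ℝ A]

theorem continuous_speed (S : SplitAbelianByAbelian H A) {x : ℝ → H} {t : ℝ → A}
    (hx : ContDiff ℝ 1 x) (ht : ContDiff ℝ 1 t) : Continuous (S.speed x t) := by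
  have hx' := hx.continuous_deriv le_rfl
  have ht' := ht.continuous_deriv le_rfl
  have h1 : Continuous fun s => S.phi (-(t s)) (deriv x s) :=
    (S.continuous_phi.comp ht.continuous.neg).clm_apply hx'
  exact Real.continuous_sqrt.comp ((ht'.norm.pow 2).add (h1.norm.pow 2))

/-- Reparametrizing by a monotone function does not change the length. -/
theorem integral_speed_comp (S : SplitAbelianByAbelian H A) {x : ℝ → H} {t : ℝ → A} {h : ℝ → ℝ}
    (hx : ContDiff ℝ 1 x) (ht : ContDiff ℝ 1 t) (hh : ContDiff ℝ 1 h) (c d : ℝ) :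
    ∫ s in c..d, deriv h s * S.speed x t (h s) = ∫ s in h c..h d, S.speed x t s := by
  have := intervalIntegral.integral_comp_mul_deriv (a := c) (b := d) (f := h) (f' := deriv h)
    (g := S.speed x t) (fun s _ => (hh.differentiable one_ne_zero s).hasDerivAt)
    (hh.continuous_deriv le_rfl).continuousOn (S.continuous_speed hx ht)
  simpa [mul_comm, Function.comp_def] using this

theorem rdist_triangle (S : SplitAbelianByAbelian H A) (p q r : S.Point) :
    S.rdist p r ≤ S.rdist p q + S.rdist q r := by
  suffices h : ∀ (x : ℝ → H) (t : ℝ → A), ContDiff ℝ 1 x → ContDiff ℝ 1 t → x 0 = p.hor →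
      t 0 = p.ver → x 1 = q.hor → t 1 = q.ver → S.rdist p r - S.rdist q r ≤ S.curveLength x t by
    linarith [S.le_rdist h]
  intro x₁ t₁ hx₁ ht₁ hx₁0 ht₁0 hx₁1 ht₁1
  suffices h : ∀ (x : ℝ → H) (t : ℝ → A), ContDiff ℝ 1 x → ContDiff ℝ 1 t → x 0 = q.hor →
      t 0 = q.ver → x 1 = r.hor → t 1 = r.ver →
      S.rdist p r - S.curveLength x₁ t₁ ≤ S.curveLength x t by
    linarith [S.le_rdist h]
  intro x₂ t₂ hx₂ ht₂ hx₂0 ht₂0 hx₂1 ht₂1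
  -- The first curve is run through on `[0, 1/2]` and the second on `[1/2, 1]`; the clocks `k₁`
  -- and `k₂` are flat at the junction, so that the concatenation is again `C¹`.
  set k₁ : ℝ → ℝ := fun s => Real.smoothTransition (2 * s) with hk₁
  set k₂ : ℝ → ℝ := fun s => Real.smoothTransition (2 * s - 1) with hk₂
  have ck₁ : ContDiff ℝ 1 k₁ := Real.smoothTransition.contDiff.comp (contDiff_const.mul contDiff_id)
  have ck₂ : ContDiff ℝ 1 k₂ :=
    Real.smoothTransition.contDiff.comp ((contDiff_const.mul contDiff_id).sub contDiff_const)
  have mk₁ : Monotone k₁ := fun a b hab => Real.smoothTransition.monotone (by linarith)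
  have mk₂ : Monotone k₂ := fun a b hab => Real.smoothTransition.monotone (by linarith)
  have e₁ : ∀ s, 1 / 2 ≤ s → k₁ s = 1 := fun s hs =>
    Real.smoothTransition.one_of_one_le (by linarith)
  have e₂ : ∀ s, s ≤ 1 / 2 → k₂ s = 0 := fun s hs =>
    Real.smoothTransition.zero_of_nonpos (by linarith)
  have d₁ : ∀ s, 1 / 2 < s → deriv k₁ s = 0 := fun s hs => by
    have : k₁ =ᶠ[nhds s] fun _ => 1 := by
      filter_upwards [lt_mem_nhds hs] with y hy using e₁ y hy.le
    rw [this.deriv_eq, deriv_const]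
  have d₂ : ∀ s, s < 1 / 2 → deriv k₂ s = 0 := fun s hs => by
    have : k₂ =ᶠ[nhds s] fun _ => 0 := by
      filter_upwards [gt_mem_nhds hs] with y hy using e₂ y hy.le
    rw [this.deriv_eq, deriv_const]
  have k₁0 : k₁ 0 = 0 := by simp [hk₁]
  have k₂1 : k₂ 1 = 1 := by norm_num [hk₂]
  set x : ℝ → H := fun s => x₁ (k₁ s) + x₂ (k₂ s) - q.hor with hx
  set t : ℝ → A := fun s => t₁ (k₁ s) + t₂ (k₂ s) - q.ver with ht
  have cx : ContDiff ℝ 1 x := ((hx₁.comp ck₁).add (hx₂.comp ck₂)).sub contDiff_const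
  have ct : ContDiff ℝ 1 t := ((ht₁.comp ck₁).add (ht₂.comp ck₂)).sub contDiff_const
  have sp : ∀ {y : ℝ → H} {u : ℝ → A} {d τ s : ℝ}, 0 ≤ d → t s = u τ →
      deriv x s = d • deriv y τ → deriv t s = d • deriv u τ →
      S.speed x t s = d * S.speed y u τ := by
    intro y u d τ s hd h1 h2 h3
    simp only [speed, h1, h2, h3, map_smul, norm_smul, Real.norm_eq_abs, abs_of_nonneg hd]
    rw [← Real.sqrt_sq hd, ← Real.sqrt_mul (sq_nonneg d), Real.sqrt_sq hd]
    congr 1; ring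
  have hI : IntervalIntegrable (S.speed x t) MeasureTheory.volume 0 (1 / 2) :=
    (S.continuous_speed cx ct).intervalIntegrable _ _
  have hI' : IntervalIntegrable (S.speed x t) MeasureTheory.volume (1 / 2) 1 :=
    (S.continuous_speed cx ct).intervalIntegrable _ _
  have L₁ : ∫ s in (0 : ℝ)..(1 / 2), S.speed x t s = S.curveLength x₁ t₁ := by
    have : ∫ s in (0 : ℝ)..(1 / 2), S.speed x t s =
        ∫ s in (0 : ℝ)..(1 / 2), deriv k₁ s * S.speed x₁ t₁ (k₁ s) := by
      refine intervalIntegral.integral_congr_Ioo_of_le (by norm_num) fun s hs => ?_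
      refine sp mk₁.deriv_nonneg ?_ ?_ ?_
      · simp [ht, e₂ s hs.2.le, ht₂0]
      · rw [hx, deriv_comp_add_comp_sub _ hx₁ hx₂ ck₁ ck₂, d₂ s hs.2]; simp
      · rw [ht, deriv_comp_add_comp_sub _ ht₁ ht₂ ck₁ ck₂, d₂ s hs.2]; simp
    rw [this, S.integral_speed_comp hx₁ ht₁ ck₁, k₁0, e₁ _ le_rfl, curveLength_eq]
  have L₂ : ∫ s in (1 / 2 : ℝ)..1, S.speed x t s = S.curveLength x₂ t₂ := by
    have : ∫ s in (1 / 2 : ℝ)..1, S.speed x t s =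
        ∫ s in (1 / 2 : ℝ)..1, deriv k₂ s * S.speed x₂ t₂ (k₂ s) := by
      refine intervalIntegral.integral_congr_Ioo_of_le (by norm_num) fun s hs => ?_
      refine sp mk₂.deriv_nonneg ?_ ?_ ?_
      · simp [ht, e₁ s hs.1.le, ht₁1]
      · rw [hx, deriv_comp_add_comp_sub _ hx₁ hx₂ ck₁ ck₂, d₁ s hs.1]; simp
      · rw [ht, deriv_comp_add_comp_sub _ ht₁ ht₂ ck₁ ck₂, d₁ s hs.1]; simp
    rw [this, S.integral_speed_comp hx₂ ht₂ ck₂, k₂1, e₂ _ le_rfl, curveLength_eq]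
  have hfin : S.rdist p r ≤ S.curveLength x t := by
    refine S.rdist_le_curveLength cx ct ?_ ?_ ?_ ?_
    · simp [hx, k₁0, e₂ 0 (by norm_num), hx₂0, hx₁0]
    · simp [ht, k₁0, e₂ 0 (by norm_num), ht₂0, ht₁0]
    · simp [hx, k₂1, e₁ 1 (by norm_num), hx₂1, hx₁1]
    · simp [ht, k₂1, e₁ 1 (by norm_num), ht₂1, ht₁1]
  rw [curveLength_eq, ← intervalIntegral.integral_add_adjacent_intervals hI hI', L₁, L₂] at hfin
  linarith

theorem norm_sub_le_integral_speed (S : SplitAbelianByAbelian H A) {x : ℝ → H} {t : ℝ → A}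
    (hx : ContDiff ℝ 1 x) (ht : ContDiff ℝ 1 t) {c d : ℝ} (hcd : c ≤ d) :
    ‖t d - t c‖ ≤ ∫ s in c..d, S.speed x t s := by
  have ht' := ht.continuous_deriv le_rfl
  rw [← intervalIntegral.integral_deriv_eq_sub (fun s _ => ht.differentiable one_ne_zero s)
    (ht'.intervalIntegrable _ _)]
  exact (intervalIntegral.norm_integral_le_integral_norm hcd).trans
    (intervalIntegral.integral_mono_on hcd (ht'.norm.intervalIntegrable _ _)
      ((S.continuous_speed hx ht).intervalIntegrable _ _)
      fun s _ => S.norm_deriv_ver_le_speed x t s)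

/-- A curve of length `l` stays inside the ellipsoid of points whose distances to the two end
points add up to at most `l`. -/
theorem norm_sub_add_norm_sub_le_curveLength (S : SplitAbelianByAbelian H A) {x : ℝ → H}
    {t : ℝ → A} (hx : ContDiff ℝ 1 x) (ht : ContDiff ℝ 1 t) {s : ℝ} (hs : s ∈ Icc (0 : ℝ) 1) :
    ‖t s - t 0‖ + ‖t 1 - t s‖ ≤ S.curveLength x t := by
  rw [curveLength_eq, ← intervalIntegral.integral_add_adjacent_intervals
    ((S.continuous_speed hx ht).intervalIntegrable 0 s)
    ((S.continuous_speed hx ht).intervalIntegrable s 1)]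
  exact add_le_add (S.norm_sub_le_integral_speed hx ht hs.1)
    (S.norm_sub_le_integral_speed hx ht hs.2)

theorem norm_ver_sub_le_rdist (S : SplitAbelianByAbelian H A) (p q : S.Point) :
    ‖q.ver - p.ver‖ ≤ S.rdist p q := by
  refine S.le_rdist fun x t hx ht _ h0 _ h1 => ?_
  simpa [h0, h1] using S.norm_sub_add_norm_sub_le_curveLength hx ht (s := 0) (by simp)

end SplitAbelianByAbelian

namespace SplitAbelianByAbelian

/-! ### Root spaces -/

section DualNorm

variable {A : Type*} [NormedAddCommGroup A] [InnerProductSpace ℝ A]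

theorem norm_sub_lt_two {e f : A} (he : ‖e‖ = 1) (hf : ‖f‖ = 1) (h : f ≠ -e) : ‖f - e‖ < 2 := by
  have h1 : 0 < ‖f + e‖ := norm_pos_iff.2 fun h0 => h (eq_neg_of_add_eq_zero_left h0)
  have h2 := norm_add_sq_real f e
  have h3 := norm_sub_sq_real f e
  rw [he, hf] at h2 h3
  nlinarith [norm_nonneg (f - e), sq_nonneg ‖f + e‖]

variable [FiniteDimensional ℝ A]

/-- The operator norm of a linear form on the Euclidean space `A`. -/
noncomputable def dualNorm (α : Module.Dual ℝ A) : ℝ := ‖LinearMap.toContinuousLinearMap α‖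

theorem dualNorm_nonneg (α : Module.Dual ℝ A) : 0 ≤ dualNorm α := norm_nonneg _

theorem dualNorm_pos {α : Module.Dual ℝ A} (h : α ≠ 0) : 0 < dualNorm α := by
  refine norm_pos_iff.2 fun h' => h ?_
  simpa using h'

theorem abs_apply_le_dualNorm (α : Module.Dual ℝ A) (w : A) : |α w| ≤ dualNorm α * ‖w‖ :=
  (LinearMap.toContinuousLinearMap α).le_opNorm w

theorem apply_le_dualNorm (α : Module.Dual ℝ A) (w : A) : α w ≤ dualNorm α * ‖w‖ :=
  (le_abs_self _).trans (abs_apply_le_dualNorm α w)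

/-- The unit gradient of a non-zero linear form. -/
theorem exists_unit_gradient {α : Module.Dual ℝ A} (h : α ≠ 0) :
    ∃ e : A, ‖e‖ = 1 ∧ ∀ w, α w = dualNorm α * inner ℝ e w := by
  have hpos := dualNorm_pos h
  set g := (InnerProductSpace.toDual ℝ A).symm (LinearMap.toContinuousLinearMap α) with hg
  have hn : ‖g‖ = dualNorm α := LinearIsometryEquiv.norm_map _ _
  refine ⟨(dualNorm α)⁻¹ • g, ?_, fun w => ?_⟩
  · rw [norm_smul, hn, norm_inv, Real.norm_of_nonneg hpos.le, inv_mul_cancel₀ hpos.ne']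
  · rw [inner_smul_left, hg, InnerProductSpace.toDual_symm_apply]
    simp [hpos.ne']

end DualNorm

section RootNorms

variable {H A : Type*} [NormedAddCommGroup H] [InnerProductSpace ℝ H]
  [NormedAddCommGroup A] [InnerProductSpace ℝ A] [FiniteDimensional ℝ A]

theorem exists_dualNorm_le (S : SplitAbelianByAbelian H A) :
    ∃ R : ℝ, 1 ≤ R ∧ ∀ α ∈ S.roots, dualNorm α ≤ R :=
  ⟨1 + ∑ α ∈ S.roots, dualNorm α,
    by linarith [Finset.sum_nonneg fun α (_ : α ∈ S.roots) => dualNorm_nonneg α],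
    fun α hα => by
      linarith [Finset.single_le_sum (fun α (_ : α ∈ S.roots) => dualNorm_nonneg α) hα]⟩

theorem exists_le_dualNorm (S : SplitAbelianByAbelian H A) :
    ∃ c : ℝ, 0 < c ∧ c ≤ 1 ∧ ∀ α ∈ S.roots, c ≤ dualNorm α := by
  have hpos : ∀ α ∈ S.roots, 0 < dualNorm α := fun α hα =>
    dualNorm_pos fun h => S.zero_notMem_roots (h ▸ hα)
  rcases S.roots.eq_empty_or_nonempty with h | h
  · exact ⟨1, one_pos, le_rfl, by simp [h]⟩
  · obtain ⟨β, hβ, hmin⟩ := S.roots.exists_min_image dualNorm h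
    exact ⟨min 1 (dualNorm β), lt_min one_pos (hpos β hβ), min_le_left _ _,
      fun α hα => (min_le_right _ _).trans (hmin α hα)⟩

theorem exists_unit_gradients (S : SplitAbelianByAbelian H A) :
    ∃ e : Module.Dual ℝ A → A, ∀ α ∈ S.roots,
      ‖e α‖ = 1 ∧ ∀ w, α w = dualNorm α * inner ℝ (e α) w := by
  have : ∀ α : Module.Dual ℝ A, ∃ e : A, α ∈ S.roots →
      ‖e‖ = 1 ∧ ∀ w, α w = dualNorm α * inner ℝ e w := by
    intro α
    by_cases h : α = 0
    · exact ⟨0, fun hα => absurd (h ▸ hα) S.zero_notMem_roots⟩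
    · obtain ⟨e, he⟩ := exists_unit_gradient h
      exact ⟨e, fun _ => he⟩
  choose e he using this
  exact ⟨e, he⟩

theorem forall_exists_eq_smul (S : SplitAbelianByAbelian H A) {e : A} (he : ‖e‖ = 1)
    (h : ∀ β ∈ S.roots, ∃ c : ℝ, ∀ w, β w = c * inner ℝ e w) (z : A) : ∃ c : ℝ, z = c • e := by
  refine ⟨inner ℝ e z, ?_⟩
  set y := z - inner ℝ e z • e with hy
  have hey : inner ℝ e y = 0 := by
    rw [hy, inner_sub_right, inner_smul_right, real_inner_self_eq_norm_sq, he]; simp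
  have hspan : ∀ β ∈ Submodule.span ℝ (S.roots : Set (Module.Dual ℝ A)), β y = 0 := by
    intro β hβ
    induction hβ using Submodule.span_induction with
    | mem β hβ =>
      obtain ⟨c, hc⟩ := h β hβ
      rw [hc, hey, mul_zero]
    | zero => rfl
    | add β γ _ _ h1 h2 => rw [LinearMap.add_apply, h1, h2, add_zero]
    | smul c β _ h1 => rw [LinearMap.smul_apply, h1, smul_zero]
  have h0 := hspan (InnerProductSpace.toDual ℝ A y : A →L[ℝ] ℝ).toLinearMap
    (S.span_roots ▸ Submodule.mem_top)
  have h1 : inner ℝ y y = 0 := by simpa using h0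
  exact sub_eq_zero.1 (inner_self_eq_zero.1 h1)

end RootNorms

variable {H A : Type*} [NormedAddCommGroup H] [InnerProductSpace ℝ H] [FiniteDimensional ℝ H]
  [NormedAddCommGroup A] [InnerProductSpace ℝ A]

/-- The orthogonal projection of `H` onto the root space of `α`. -/
noncomputable def rootProj (S : SplitAbelianByAbelian H A) (α : Module.Dual ℝ A) : H →L[ℝ] H :=
  (rootSpace S.ad α).starProjection

theorem rootProj_mem (S : SplitAbelianByAbelian H A) (α : Module.Dual ℝ A) (x : H) :
    S.rootProj α x ∈ rootSpace S.ad α := Submodule.starProjection_apply_mem _ x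

theorem rootProj_of_mem (S : SplitAbelianByAbelian H A) {α : Module.Dual ℝ A} {x : H}
    (hx : x ∈ rootSpace S.ad α) : S.rootProj α x = x := Submodule.starProjection_eq_self_iff.2 hx

theorem norm_rootProj_le (S : SplitAbelianByAbelian H A) (α : Module.Dual ℝ A) (x : H) :
    ‖S.rootProj α x‖ ≤ ‖x‖ := Submodule.norm_starProjection_apply_le _ x

theorem rootProj_of_mem_of_ne (S : SplitAbelianByAbelian H A) {α β : Module.Dual ℝ A}
    (hα : α ∈ S.roots) (hβ : β ∈ S.roots) (hne : α ≠ β) {x : H} (hx : x ∈ rootSpace S.ad β) :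
    S.rootProj α x = 0 :=
  (Submodule.starProjection_apply_eq_zero_iff _).2
    ((S.rootSpace_orthogonal β hβ α hα hne.symm) hx)

theorem sum_rootProj (S : SplitAbelianByAbelian H A) (x : H) :
    ∑ α ∈ S.roots, S.rootProj α x = x := by
  have hV : OrthogonalFamily ℝ (fun i : S.roots => rootSpace S.ad i.1)
      fun i => (rootSpace S.ad i.1).subtypeₗᵢ :=
    OrthogonalFamily.of_pairwise fun i j hij =>
      S.rootSpace_orthogonal i i.2 j j.2 fun h => hij (Subtype.ext h)
  have hx : x ∈ ⨆ i : S.roots, rootSpace S.ad i.1 := by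
    rw [iSup_subtype (p := fun i => i ∈ S.roots) (f := fun i => rootSpace S.ad i.1),
      S.iSup_rootSpace]
    trivial
  have := hV.sum_projection_of_mem_iSup x hx
  rw [← Finset.sum_coe_sort]
  exact this

theorem phi_mem_rootSpace (S : SplitAbelianByAbelian H A) (w : A) {α : Module.Dual ℝ A} {x : H}
    (hx : x ∈ rootSpace S.ad α) : S.phi w x ∈ rootSpace S.ad α := by
  have : CompleteSpace H := FiniteDimensional.complete ℝ H
  let _ : NormedAlgebra ℚ (H →L[ℝ] H) := NormedAlgebra.restrictScalars ℚ ℝ (H →L[ℝ] H)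
  rw [rootSpace, Submodule.mem_iInf] at hx ⊢
  intro t
  have hc : Commute (S.ad t) (S.phi w) := (S.ad_commute t w).exp_right
  have hc' : Commute ((S.ad t : H →L[ℝ] H) : H →ₗ[ℝ] H) (S.phi w : H →ₗ[ℝ] H) := by
    ext y
    exact congrArg (fun T : H →L[ℝ] H => T y) hc
  exact Module.End.mapsTo_maxGenEigenspace_of_comm hc' (α t) (hx t)

theorem rootProj_phi (S : SplitAbelianByAbelian H A) {α : Module.Dual ℝ A} (hα : α ∈ S.roots)
    (w : A) (x : H) : S.rootProj α (S.phi w x) = S.phi w (S.rootProj α x) := by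
  conv_lhs => rw [← S.sum_rootProj x, map_sum, map_sum]
  rw [Finset.sum_eq_single_of_mem α hα fun β hβ hne =>
    S.rootProj_of_mem_of_ne hα hβ hne.symm (S.phi_mem_rootSpace w (S.rootProj_mem β x))]
  exact S.rootProj_of_mem (S.phi_mem_rootSpace w (S.rootProj_mem α x))

theorem pow_finrank_apply_eq_zero (S : SplitAbelianByAbelian H A) {α : Module.Dual ℝ A} {z : H}
    (hz : z ∈ rootSpace S.ad α) (w : A) :
    ((S.ad w - α w • (1 : H →L[ℝ] H)) ^ Module.finrank ℝ H) z = 0 := by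
  rw [rootSpace, Submodule.mem_iInf] at hz
  have h := hz w
  rw [Module.End.maxGenEigenspace_eq_genEigenspace_finrank, Module.End.mem_genEigenspace_nat] at h
  have h2 : ∀ k : ℕ, ∀ y : H, ((S.ad w - α w • (1 : H →L[ℝ] H)) ^ k) y =
      ((((S.ad w : H →L[ℝ] H) : H →ₗ[ℝ] H) - α w • (1 : Module.End ℝ H)) ^ k) y := by
    intro k
    induction k with
    | zero => intro y; rfl
    | succ k ih =>
      intro y
      rw [pow_succ, pow_succ]
      exact ih _
  rw [h2]
  exact h

/-- On the root space of `α` the operator `φ(w)` is `exp (α w)` times a unipotent operator, which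
grows at most polynomially in `w`. -/
theorem norm_phi_apply_le (S : SplitAbelianByAbelian H A) {α : Module.Dual ℝ A} {z : H}
    (hz : z ∈ rootSpace S.ad α) (w : A) :
    ‖S.phi w z‖ ≤ Real.exp (α w) * ((Module.finrank ℝ H) *
      (1 + ‖S.ad w - α w • (1 : H →L[ℝ] H)‖) ^ Module.finrank ℝ H) * ‖z‖ := by
  have : CompleteSpace H := FiniteDimensional.complete ℝ H
  let _ : NormedAlgebra ℚ (H →L[ℝ] H) := NormedAlgebra.restrictScalars ℚ ℝ (H →L[ℝ] H)
  set m := Module.finrank ℝ H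
  set N := S.ad w - α w • (1 : H →L[ℝ] H) with hN
  have h0 : ∀ k, m ≤ k → (N ^ k) z = 0 := by
    intro k hk
    obtain ⟨j, rfl⟩ := Nat.exists_eq_add_of_le' hk
    rw [pow_add]
    change (N ^ j) ((N ^ m) z) = 0
    rw [S.pow_finrank_apply_eq_zero hz w, map_zero]
  have h1 : S.phi w = Real.exp (α w) • NormedSpace.exp N := by
    have hc : Commute (algebraMap ℝ (H →L[ℝ] H) (α w)) N := Algebra.commute_algebraMap_left _ _
    have : S.ad w = algebraMap ℝ (H →L[ℝ] H) (α w) + N := by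
      rw [hN, Algebra.algebraMap_eq_smul_one]; abel
    rw [phi, this, NormedSpace.exp_add_of_commute hc, ← NormedSpace.algebraMap_exp_comm,
      Real.exp_eq_exp_ℝ, ← Algebra.smul_def]
  have h2 : NormedSpace.exp N z = ∑ k ∈ Finset.range m, ((k.factorial : ℝ)⁻¹) • (N ^ k) z := by
    have hs := (NormedSpace.exp_series_hasSum_exp' (𝕂 := ℝ) N).mapL
      (ContinuousLinearMap.apply ℝ H z)
    refine hs.unique (hasSum_sum_of_ne_finset_zero fun k hk => ?_)
    have := h0 k (by simpa using hk)
    simp [this]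
  have h3 : ‖NormedSpace.exp N z‖ ≤ m * (1 + ‖N‖) ^ m * ‖z‖ := by
    rw [h2]
    refine (norm_sum_le _ _).trans ?_
    refine (Finset.sum_le_card_nsmul _ _ ((1 + ‖N‖) ^ m * ‖z‖) fun k hk => ?_).trans ?_
    · rw [norm_smul]
      have e1 : ‖((k.factorial : ℝ)⁻¹)‖ ≤ 1 := by
        rw [norm_inv, Real.norm_natCast]
        exact inv_le_one_of_one_le₀ (by exact_mod_cast k.factorial_pos)
      have e2 : ‖(N ^ k) z‖ ≤ (1 + ‖N‖) ^ m * ‖z‖ := by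
        have e3 : ∀ j : ℕ, ‖(N ^ j) z‖ ≤ ‖N‖ ^ j * ‖z‖ := by
          intro j
          induction j with
          | zero => simp
          | succ j ih =>
            rw [pow_succ', pow_succ', mul_assoc]
            exact (N.le_opNorm _).trans (mul_le_mul_of_nonneg_left ih (norm_nonneg N))
        refine (e3 k).trans ?_
        gcongr
        calc ‖N‖ ^ k ≤ (1 + ‖N‖) ^ k := by gcongr; linarith
          _ ≤ _ := pow_le_pow_right₀ (by linarith [norm_nonneg N]) (Finset.mem_range.1 hk).le
      calc _ ≤ 1 * ((1 + ‖N‖) ^ m * ‖z‖) := by gcongr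
        _ = _ := one_mul _
    · simp [mul_assoc]
  rw [h1]
  change ‖Real.exp (α w) • (NormedSpace.exp N z)‖ ≤ _
  rw [norm_smul, Real.norm_of_nonneg (Real.exp_pos _).le, mul_assoc]
  gcongr

variable [FiniteDimensional ℝ A]

theorem exists_norm_phi_le (S : SplitAbelianByAbelian H A) :
    ∃ K : ℝ, ∃ n : ℕ, 1 ≤ K ∧ ∀ α ∈ S.roots, ∀ z ∈ rootSpace S.ad α, ∀ w : A,
      ‖S.phi w z‖ ≤ K * (1 + ‖w‖) ^ n * Real.exp (α w) * ‖z‖ := by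
  obtain ⟨R, hR, hRα⟩ := S.exists_dualNorm_le
  obtain ⟨M, hM⟩ : ∃ M : ℝ, ∀ w, ‖S.ad w‖ ≤ M * ‖w‖ :=
    ⟨_, (LinearMap.toContinuousLinearMap S.ad).le_opNorm⟩
  set m := Module.finrank ℝ H
  set M' := 1 + |M| + R
  have hM' : 1 ≤ M' := by have := abs_nonneg M; simp only [M']; linarith
  refine ⟨1 + m * M' ^ m, m, by have : (0 : ℝ) ≤ m * M' ^ m := by positivity
                                linarith, fun α hα z hz w => ?_⟩
  have hN : 1 + ‖S.ad w - α w • (1 : H →L[ℝ] H)‖ ≤ M' * (1 + ‖w‖) := by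
    have h1 : ‖α w • (1 : H →L[ℝ] H)‖ ≤ R * ‖w‖ := by
      rw [norm_smul, Real.norm_eq_abs]
      have h2 : ‖(1 : H →L[ℝ] H)‖ ≤ 1 := ContinuousLinearMap.norm_id_le
      calc |α w| * ‖(1 : H →L[ℝ] H)‖ ≤ |α w| * 1 := by gcongr
        _ ≤ dualNorm α * ‖w‖ := by rw [mul_one]; exact abs_apply_le_dualNorm α w
        _ ≤ R * ‖w‖ := by gcongr; exact hRα α hα
    have h3 := norm_sub_le (S.ad w) (α w • (1 : H →L[ℝ] H))
    have h4 : M * ‖w‖ ≤ |M| * ‖w‖ := by gcongr; exact le_abs_self M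
    have h5 := hM w
    have h6 := norm_nonneg w
    have h7 := abs_nonneg M
    simp only [M']
    nlinarith
  refine (S.norm_phi_apply_le hz w).trans ?_
  calc Real.exp (α w) * (m * (1 + ‖S.ad w - α w • (1 : H →L[ℝ] H)‖) ^ m) * ‖z‖
      ≤ Real.exp (α w) * (m * (M' * (1 + ‖w‖)) ^ m) * ‖z‖ := by gcongr
    _ = (m * M' ^ m) * ((1 + ‖w‖) ^ m * Real.exp (α w) * ‖z‖) := by rw [mul_pow]; ring
    _ ≤ (1 + m * M' ^ m) * ((1 + ‖w‖) ^ m * Real.exp (α w) * ‖z‖) := by gcongr; linarith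
    _ = _ := by ring

end SplitAbelianByAbelian

namespace SplitAbelianByAbelian

variable {H A : Type*} [NormedAddCommGroup H] [InnerProductSpace ℝ H] [FiniteDimensional ℝ H]
  [NormedAddCommGroup A] [InnerProductSpace ℝ A]

/-! ### Distances and horizontal displacements -/

theorem exists_one_add_pow_le_exp (n : ℕ) {a : ℝ} (ha : 0 < a) :
    ∃ K : ℝ, 1 ≤ K ∧ ∀ r : ℝ, 0 ≤ r → (1 + r) ^ n ≤ K * Real.exp (a * r) := by
  set m : ℝ := n + 1 with hm
  have hm0 : 0 < m := by positivity
  refine ⟨(1 + m / a) ^ n, one_le_pow₀ (by have : 0 < m / a := by positivity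
                                           linarith), fun r hr => ?_⟩
  have h1 : 1 + r ≤ (1 + m / a) * Real.exp (a / m * r) := by
    have h2 := Real.add_one_le_exp (a / m * r)
    have h3 : 1 + r ≤ (1 + m / a) * (a / m * r + 1) := by
      have e : m / a * (a / m * r) = r := by field_simp
      have : 0 ≤ m / a := by positivity
      have : 0 ≤ a / m * r := by positivity
      nlinarith
    exact h3.trans (by gcongr)
  calc (1 + r) ^ n ≤ ((1 + m / a) * Real.exp (a / m * r)) ^ n := by gcongr
    _ = (1 + m / a) ^ n * Real.exp (n * (a / m * r)) := by rw [mul_pow, Real.exp_nat_mul]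
    _ ≤ (1 + m / a) ^ n * Real.exp (a * r) := by
      refine mul_le_mul_of_nonneg_left (Real.exp_le_exp.2 ?_) (by positivity)
      have e : n * (a / m * r) = (n / m) * (a * r) := by ring
      rw [e]
      have : n / m ≤ 1 := by rw [div_le_one hm0]; linarith
      have : 0 ≤ a * r := by positivity
      nlinarith

section Loops

theorem rdist_loop_le [FiniteDimensional ℝ A] (S : SplitAbelianByAbelian H A) {e v : A}
    (he : ‖e‖ = 1) {r : ℝ} (hr : 0 ≤ r) (x : H) {ζ : H} (h : ‖S.phi (-(v + r • e)) ζ‖ ≤ 1) :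
    S.rdist ⟨x, v⟩ ⟨x + ζ, v⟩ ≤ 2 * r + 1 := by
  have hn : ‖r • e‖ = r := by rw [norm_smul, he, Real.norm_of_nonneg hr, mul_one]
  have h1 := S.rdist_ver_le x v (v + r • e)
  have h2 := S.rdist_hor_le x (x + ζ) (v + r • e)
  have h3 := S.rdist_ver_le (x + ζ) (v + r • e) v
  rw [add_sub_cancel_left] at h1 h2
  rw [sub_add_cancel_left, norm_neg] at h3
  linarith [S.rdist_triangle ⟨x, v⟩ ⟨x, v + r • e⟩ ⟨x + ζ, v⟩,
    S.rdist_triangle ⟨x, v + r • e⟩ ⟨x + ζ, v + r • e⟩ ⟨x + ζ, v⟩]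

theorem rdist_loops_le [FiniteDimensional ℝ A] (S : SplitAbelianByAbelian H A) {v : A} {r : ℝ}
    (hr : 0 ≤ r) {e : Module.Dual ℝ A → A} {ζ : Module.Dual ℝ A → H}
    (T : Finset (Module.Dual ℝ A)) (he : ∀ α ∈ T, ‖e α‖ = 1)
    (h : ∀ α ∈ T, ‖S.phi (-(v + r • e α)) (ζ α)‖ ≤ 1) (x : H) :
    S.rdist ⟨x, v⟩ ⟨x + ∑ α ∈ T, ζ α, v⟩ ≤ T.card * (2 * r + 1) := by
  classical
  induction T using Finset.induction_on with
  | empty => simp [S.rdist_self]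
  | insert β T hβ ih =>
    have h1 := ih (fun α hα => he α (Finset.mem_insert_of_mem hα))
      fun α hα => h α (Finset.mem_insert_of_mem hα)
    have h2 := S.rdist_loop_le (he β (Finset.mem_insert_self β T)) hr (x + ∑ α ∈ T, ζ α)
      (h β (Finset.mem_insert_self β T))
    rw [Finset.sum_insert hβ, Finset.card_insert_of_notMem hβ, add_comm (ζ β), ← add_assoc]
    push_cast
    linarith [S.rdist_triangle ⟨x, v⟩ ⟨x + ∑ α ∈ T, ζ α, v⟩ ⟨x + ∑ α ∈ T, ζ α + ζ β, v⟩]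

end Loops

variable [FiniteDimensional ℝ A]

/-- The distance controls the horizontal displacement in the direction of the root space of `α`:
a curve of length `d` from `p` to `q` climbs from `p` by at most half of
`d + ‖q.ver - p.ver‖`, and at a height `h` above `p` a unit of length buys a displacement of at most
`exp (‖α‖ h)`, up to a polynomial factor. -/
theorem exists_norm_phi_rootProj_le (S : SplitAbelianByAbelian H A) :
    ∃ K : ℝ, ∃ n : ℕ, 1 ≤ K ∧ ∀ α ∈ S.roots, ∀ p q : S.Point,
      ‖S.phi (-p.ver) (S.rootProj α (q.hor - p.hor))‖ ≤ K * (1 + S.rdist p q) ^ n *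
        Real.exp (dualNorm α * ((S.rdist p q + ‖q.ver - p.ver‖) / 2)) := by
  obtain ⟨K, n, hK, hphi⟩ := S.exists_norm_phi_le
  obtain ⟨R, hR, hRα⟩ := S.exists_dualNorm_le
  refine ⟨K * 2 ^ (n + 1) * Real.exp (R / 2), n + 1, ?_, fun α hα p q => ?_⟩
  · have h1 : (1 : ℝ) ≤ 2 ^ (n + 1) := one_le_pow₀ one_le_two
    have h2 : 1 ≤ Real.exp (R / 2) := Real.one_le_exp (by linarith)
    nlinarith [mul_le_mul hK h1 zero_le_one (by linarith)]
  set d := S.rdist p q with hd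
  have hd0 : 0 ≤ d := S.rdist_nonneg p q
  obtain ⟨x, t, hx, ht, hx0, ht0, hx1, ht1, hl⟩ :=
    S.exists_curveLength_lt (show S.rdist p q < d + 1 by linarith)
  set l := S.curveLength x t
  have hl0 : 0 ≤ l := S.curveLength_nonneg x t
  set D := ‖q.ver - p.ver‖ with hD
  have hα0 := dualNorm_nonneg α
  set M := K * (1 + l) ^ n * Real.exp (dualNorm α * ((l + D) / 2)) with hM
  have hM0 : 0 ≤ M := by positivity
  set T : H →L[ℝ] H := (S.phi (-p.ver)).comp (S.rootProj α) with hT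
  have hbound : ∀ s ∈ Icc (0 : ℝ) 1, ‖T (deriv x s)‖ ≤ M * S.speed x t s := by
    intro s hs
    have h1 := S.norm_sub_add_norm_sub_le_curveLength hx ht hs
    rw [ht0, ht1] at h1
    have h2 : ‖t s - p.ver‖ ≤ (l + D) / 2 := by
      have : ‖t s - p.ver‖ ≤ ‖q.ver - p.ver‖ + ‖q.ver - t s‖ := by
        rw [show t s - p.ver = (q.ver - p.ver) - (q.ver - t s) by abel]
        exact norm_sub_le _ _
      linarith
    have h3 : T (deriv x s) =
        S.phi (t s - p.ver) (S.rootProj α (S.phi (-(t s)) (deriv x s))) := by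
      rw [S.rootProj_phi hα, ← S.phi_add_apply, hT]
      simp [sub_eq_add_neg]
    rw [h3]
    refine (hphi α hα _ (S.rootProj_mem α _) _).trans ?_
    have h4 : ‖S.rootProj α (S.phi (-(t s)) (deriv x s))‖ ≤ S.speed x t s :=
      (S.norm_rootProj_le α _).trans (S.norm_deriv_hor_le_speed x t s)
    have h5 : ‖t s - p.ver‖ ≤ l := by linarith [norm_nonneg (q.ver - t s)]
    have h6 : α (t s - p.ver) ≤ dualNorm α * ((l + D) / 2) :=
      (apply_le_dualNorm α _).trans (by gcongr)
    rw [hM]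
    gcongr
  have hx' := hx.continuous_deriv le_rfl
  have hcont : Continuous fun s => T (deriv x s) := T.continuous.comp hx'
  have hint : ∫ s in (0 : ℝ)..1, T (deriv x s) = T (q.hor - p.hor) := by
    rw [T.intervalIntegral_comp_comm (hx'.intervalIntegrable _ _),
      intervalIntegral.integral_deriv_eq_sub (fun s _ => hx.differentiable one_ne_zero s)
        (hx'.intervalIntegrable _ _), hx1, hx0]
  have hfin : ‖T (q.hor - p.hor)‖ ≤ M * l := by
    rw [← hint]
    refine (intervalIntegral.norm_integral_le_integral_norm zero_le_one).trans ?_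
    have : ∫ s in (0 : ℝ)..1, M * S.speed x t s = M * l := by
      rw [intervalIntegral.integral_const_mul]; rfl
    rw [← this]
    exact intervalIntegral.integral_mono_on zero_le_one (hcont.norm.intervalIntegrable _ _)
      (((S.continuous_speed hx ht).const_smul M).intervalIntegrable _ _) hbound
  refine le_trans hfin ?_
  have e1 : Real.exp (dualNorm α * ((l + D) / 2)) ≤
      Real.exp (R / 2) * Real.exp (dualNorm α * ((d + D) / 2)) := by
    rw [← Real.exp_add]
    have := hRα α hα
    gcongr
    nlinarith
  have e2 : (1 + l) ^ n * l ≤ 2 ^ (n + 1) * (1 + d) ^ (n + 1) := by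
    calc (1 + l) ^ n * l ≤ (1 + l) ^ n * (1 + l) := by gcongr; linarith
      _ = (1 + l) ^ (n + 1) := (pow_succ _ _).symm
      _ ≤ (2 * (1 + d)) ^ (n + 1) := by gcongr; linarith
      _ = _ := mul_pow _ _ _
  calc M * l = K * ((1 + l) ^ n * l) * Real.exp (dualNorm α * ((l + D) / 2)) := by rw [hM]; ring
    _ ≤ K * (2 ^ (n + 1) * (1 + d) ^ (n + 1)) *
        (Real.exp (R / 2) * Real.exp (dualNorm α * ((d + D) / 2))) := by gcongr
    _ = _ := by ring

/-- Climbing slightly more than `b` in the direction of the gradient of `α` makes a displacement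
of size `exp (‖α‖ b)` in the root space of `α` short. -/
theorem exists_climb (S : SplitAbelianByAbelian H A) {ω : ℝ} (hω : 0 < ω) :
    ∃ K : ℝ, 1 ≤ K ∧ ∀ α ∈ S.roots, ∀ e : A, ‖e‖ = 1 → (∀ w, α w = dualNorm α * inner ℝ e w) →
      ∀ b r : ℝ, 0 ≤ b → (1 + ω) * b + K ≤ r → ∀ v : A, ∀ ζ ∈ rootSpace S.ad α,
        ‖S.phi (-v) ζ‖ ≤ Real.exp (dualNorm α * b) → ‖S.phi (-(v + r • e)) ζ‖ ≤ 1 := by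
  obtain ⟨K₀, n, hK₀, hphi⟩ := S.exists_norm_phi_le
  obtain ⟨c, hc, -, hcα⟩ := S.exists_le_dualNorm
  set a := c * ω / (1 + ω) with ha
  have ha0 : 0 < a := by positivity
  obtain ⟨K₁, hK₁, hpow⟩ := exists_one_add_pow_le_exp n ha0
  have hlog : 0 ≤ Real.log (K₀ * K₁) := Real.log_nonneg (by nlinarith)
  set K := (1 + ω) * Real.log (K₀ * K₁) / c + 1 with hK
  have hK1 : 1 ≤ K := by
    have : 0 ≤ (1 + ω) * Real.log (K₀ * K₁) / c := by positivity
    linarith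
  refine ⟨K, hK1, fun α hα e he hαe b r hb hr v ζ hζ hζb => ?_⟩
  have hr0 : 0 ≤ r := by nlinarith
  have hne : α (-(r • e)) = -(dualNorm α * r) := by
    rw [map_neg, map_smul, hαe, real_inner_self_eq_norm_sq, he]; simp [mul_comm]
  have hnorm : ‖-(r • e)‖ = r := by
    rw [norm_neg, norm_smul, he, Real.norm_of_nonneg hr0, mul_one]
  have h1 : S.phi (-(v + r • e)) ζ = S.phi (-(r • e)) (S.phi (-v) ζ) := by
    rw [← S.phi_add_apply]; congr 1; simp
  rw [h1]
  refine (hphi α hα _ (S.phi_mem_rootSpace _ hζ) _).trans ?_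
  rw [hnorm, hne]
  have hexp : Real.log (K₀ * K₁) + a * r + (-(dualNorm α * r) + dualNorm α * b) ≤ 0 := by
    have hcα' := hcα α hα
    have h2 : (1 + ω) * (r - b) ≥ ω * r + K := by nlinarith
    have h3 : c * (r - b) ≤ dualNorm α * (r - b) := by
      gcongr
      nlinarith
    have h4 : Real.log (K₀ * K₁) + a * r ≤ c * (r - b) := by
      have h5 : (1 + ω) * (Real.log (K₀ * K₁) + a * r) ≤ (1 + ω) * (c * (r - b)) := by
        have h6 : (1 + ω) * (a * r) = c * (ω * r) := by rw [ha]; field_simp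
        have h7 : (1 + ω) * Real.log (K₀ * K₁) = c * (K - 1) := by rw [hK]; field_simp; ring
        nlinarith
      exact le_of_mul_le_mul_left h5 (by positivity)
    linarith
  calc K₀ * (1 + r) ^ n * Real.exp (-(dualNorm α * r)) * ‖S.phi (-v) ζ‖
      ≤ K₀ * (K₁ * Real.exp (a * r)) * Real.exp (-(dualNorm α * r)) *
        Real.exp (dualNorm α * b) := by
        gcongr
        exact hpow r hr0
    _ = Real.exp (Real.log (K₀ * K₁) + a * r + (-(dualNorm α * r) + dualNorm α * b)) := by
        rw [Real.exp_add, Real.exp_add, Real.exp_add, Real.exp_log (by positivity)]; ring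
    _ ≤ 1 := Real.exp_le_one_iff.2 hexp

theorem exists_rdist_le_log (S : SplitAbelianByAbelian H A) :
    ∃ K : ℝ, 1 ≤ K ∧ ∀ (x y : H) (v w : A), S.rdist ⟨x, v⟩ ⟨y, w⟩ ≤
      ‖w - v‖ + K * (1 + Real.log (1 + ‖S.phi (-v) (y - x)‖)) := by
  obtain ⟨e, he⟩ := S.exists_unit_gradients
  obtain ⟨c, hc, hc1, hcα⟩ := S.exists_le_dualNorm
  obtain ⟨K, hK, hclimb⟩ := S.exists_climb one_pos
  set N : ℝ := (S.roots.card : ℝ) with hN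
  have hN0 : 0 ≤ N := Nat.cast_nonneg _
  refine ⟨1 + N * (4 / c + 2 * K + 1), ?_, fun x y v w => ?_⟩
  · have : 0 ≤ N * (4 / c + 2 * K + 1) := by positivity
    linarith
  set l := Real.log (1 + ‖S.phi (-v) (y - x)‖) with hl
  have hnn := norm_nonneg (S.phi (-v) (y - x))
  have hl0 : 0 ≤ l := Real.log_nonneg (by linarith)
  set r := (1 + 1) * (l / c) + K with hr
  have hlc : 0 ≤ l / c := by positivity
  have hr0 : 0 ≤ r := by rw [hr]; linarith
  have h1 := S.rdist_loops_le (v := v) hr0 (e := e) (ζ := fun α => S.rootProj α (y - x)) S.roots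
    (fun α hα => (he α hα).1) (fun α hα => by
      refine hclimb α hα _ (he α hα).1 (he α hα).2 (l / c) r hlc le_rfl v _
        (S.rootProj_mem α _) ?_
      rw [← S.rootProj_phi hα]
      refine (S.norm_rootProj_le α _).trans ?_
      have h2 : ‖S.phi (-v) (y - x)‖ ≤ Real.exp l := by
        rw [hl, Real.exp_log (by linarith)]; linarith
      refine h2.trans (Real.exp_le_exp.2 ?_)
      calc l = c * (l / c) := by field_simp
        _ ≤ dualNorm α * (l / c) := by gcongr; exact hcα α hα) x
  rw [S.sum_rootProj, add_sub_cancel] at h1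
  have h2 := S.rdist_ver_le y v w
  have h3 := S.rdist_triangle ⟨x, v⟩ ⟨y, v⟩ ⟨y, w⟩
  have h4 : N * (2 * r + 1) ≤ (1 + N * (4 / c + 2 * K + 1)) * (1 + l) := by
    have e1 : N * (2 * r + 1) = N * (4 / c) * l + N * (2 * K + 1) := by rw [hr]; ring
    rw [e1]
    have : 0 ≤ N * (4 / c) := by positivity
    have : 0 ≤ N * (2 * K + 1) * l := by positivity
    nlinarith
  linarith

theorem mul_climb_le {N c b K : ℝ} (hN : 1 ≤ N) (hc : 0 < c) (hb : 0 ≤ b) (hK : 0 ≤ K) :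
    (2 * N - c) * ((1 + c / (4 * N)) * b + K) + N ≤
      N * (1 - c / (4 * N)) * (2 * b) + (2 * N * K + N) := by
  have h1 : N * (c / (4 * N)) = c / 4 := by field_simp
  have h2 : 0 ≤ c / (4 * N) := by positivity
  set u := c / (4 * N)
  have h3 : (2 * N - c) * ((1 + u) * b + K) + N =
      (2 * N + 2 * (N * u) - c - c * u) * b + (2 * N - c) * K + N := by ring
  have h4 : N * (1 - u) * (2 * b) = (2 * N - 2 * (N * u)) * b := by ring
  rw [h3, h4, h1]
  nlinarith [mul_nonneg hc.le hK, mul_nonneg (mul_nonneg hc.le h2) hb]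

/-- Changing the horizontal coordinate by a displacement which is of size `exp (‖α‖ b)` in each
root space costs strictly less than the `2 b` per root needed for separate excursions in the
directions of the gradients of the roots. If two gradients are not opposite, their
excursions can be joined to one along a triangle; if all are opposite, then `A` is a line and the
last excursion need not return. -/
theorem exists_rdist_translate_le (S : SplitAbelianByAbelian H A) (hS : S.roots.Nonempty) :
    ∃ ω K : ℝ, 0 < ω ∧ ω < 1 ∧ 1 ≤ K ∧ ∀ (x y : H) (v : A) (b : ℝ), 0 ≤ b →
      (∀ α ∈ S.roots, ‖S.phi (-v) (S.rootProj α (y - x))‖ ≤ Real.exp (dualNorm α * b)) →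
      ∃ w, S.rdist ⟨x, v⟩ ⟨y, w⟩ ≤ S.roots.card * (1 - ω) * (2 * b) + K ∧
        (w = v ∨ ∃ e : A, ‖e‖ = 1 ∧ ∀ z, ∃ c : ℝ, z = c • e) := by
  classical
  obtain ⟨e, he⟩ := S.exists_unit_gradients
  set N : ℝ := (S.roots.card : ℝ) with hN
  have hN1 : 1 ≤ N := Nat.one_le_cast.2 hS.card_pos
  by_cases hpair : ∃ α ∈ S.roots, ∃ β ∈ S.roots, α ≠ β ∧ e β ≠ -e α
  -- The excursions for `α` and `β` save `c r` by crossing from `r e α` to `r e β`; this exceeds the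
  -- loss `ω (2 b)` per root which is the price for removing the polynomial factors.
  · obtain ⟨α, hα, β, hβ, hne, hop⟩ := hpair
    set c := 2 - ‖e β - e α‖ with hc
    have hc0 : 0 < c := by linarith [norm_sub_lt_two (he α hα).1 (he β hβ).1 hop]
    have hc2 : c ≤ 2 := by linarith [norm_nonneg (e β - e α)]
    have hω : 0 < c / (4 * N) := by positivity
    obtain ⟨K, hK, hclimb⟩ := S.exists_climb hω
    refine ⟨c / (4 * N), 2 * N * K + N, hω, ?_, by nlinarith, fun x y v b hb hxy => ?_⟩
    · rw [div_lt_one (by positivity)]; linarith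
    set r := (1 + c / (4 * N)) * b + K with hr
    have hr0 : 0 ≤ r := by positivity
    set ζ : Module.Dual ℝ A → H := fun α => S.rootProj α (y - x) with hζ
    have hshort : ∀ γ ∈ S.roots, ‖S.phi (-(v + r • e γ)) (ζ γ)‖ ≤ 1 := fun γ hγ =>
      hclimb γ hγ _ (he γ hγ).1 (he γ hγ).2 b r hb le_rfl v _ (S.rootProj_mem γ _) (hxy γ hγ)
    refine ⟨v, ?_, Or.inl rfl⟩
    set T := (S.roots.erase α).erase β with hT
    have hβ' : β ∈ S.roots.erase α := Finset.mem_erase.2 ⟨hne.symm, hβ⟩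
    have hTs : T ⊆ S.roots := (Finset.erase_subset _ _).trans (Finset.erase_subset _ _)
    have hcard : (T.card : ℝ) = N - 2 := by
      have h1 := Finset.card_erase_add_one hα
      have h2 := Finset.card_erase_add_one hβ'
      rw [hN, ← h1, ← h2]; push_cast; ring
    have hsum : y = x + ζ α + ζ β + ∑ γ ∈ T, ζ γ := by
      have h1 : ζ α + (ζ β + ∑ γ ∈ T, ζ γ) = y - x := by
        rw [Finset.add_sum_erase _ _ hβ', Finset.add_sum_erase _ _ hα]
        exact S.sum_rootProj _
      rw [add_assoc, add_assoc, h1, add_sub_cancel]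
    have hnr : ∀ γ ∈ S.roots, ‖r • e γ‖ = r := fun γ hγ => by
      rw [norm_smul, (he γ hγ).1, Real.norm_of_nonneg hr0, mul_one]
    -- Five steps around the triangle with vertices `v`, `v + r e α`, `v + r e β`, then the loops.
    have d1 := S.rdist_ver_le x v (v + r • e α)
    have d2 := S.rdist_hor_le x (x + ζ α) (v + r • e α)
    have d3 := S.rdist_ver_le (x + ζ α) (v + r • e α) (v + r • e β)
    have d4 := S.rdist_hor_le (x + ζ α) (x + ζ α + ζ β) (v + r • e β)
    have d5 := S.rdist_ver_le (x + ζ α + ζ β) (v + r • e β) v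
    have d6 := S.rdist_loops_le (v := v) hr0 (e := e) (ζ := ζ) T
      (fun γ hγ => (he γ (hTs hγ)).1) (fun γ hγ => hshort γ (hTs hγ)) (x + ζ α + ζ β)
    rw [add_sub_cancel_left, hnr α hα] at d1
    rw [add_sub_cancel_left] at d2 d4
    rw [sub_add_cancel_left, norm_neg, hnr β hβ] at d5
    rw [add_sub_add_left_eq_sub, ← smul_sub, norm_smul, Real.norm_of_nonneg hr0] at d3
    rw [← hsum, hcard] at d6
    have d2' := d2.trans (hshort α hα)
    have d4' := d4.trans (hshort β hβ)
    have t1 := S.rdist_triangle ⟨x, v⟩ ⟨x, v + r • e α⟩ ⟨y, v⟩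
    have t2 := S.rdist_triangle ⟨x, v + r • e α⟩ ⟨x + ζ α, v + r • e α⟩ ⟨y, v⟩
    have t3 := S.rdist_triangle ⟨x + ζ α, v + r • e α⟩ ⟨x + ζ α, v + r • e β⟩ ⟨y, v⟩
    have t4 := S.rdist_triangle ⟨x + ζ α, v + r • e β⟩ ⟨x + ζ α + ζ β, v + r • e β⟩ ⟨y, v⟩
    have t5 := S.rdist_triangle ⟨x + ζ α + ζ β, v + r • e β⟩ ⟨x + ζ α + ζ β, v⟩ ⟨y, v⟩
    refine le_trans ?_ (mul_climb_le hN1 hc0 hb (by linarith : (0 : ℝ) ≤ K))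
    rw [← hr]
    have hfin : (2 * N - c) * r + N = r + 1 + r * ‖e β - e α‖ + 1 + r + (N - 2) * (2 * r + 1) := by
      rw [hc]; ring
    linarith
  · push Not at hpair
    obtain ⟨α, hα⟩ := hS
    have hω : 0 < 1 / (4 * N) := by positivity
    obtain ⟨K, hK, hclimb⟩ := S.exists_climb hω
    refine ⟨1 / (4 * N), 2 * N * K + N, hω, ?_, by nlinarith, fun x y v b hb hxy => ?_⟩
    · rw [div_lt_one (by positivity)]; linarith
    set r := (1 + 1 / (4 * N)) * b + K with hr
    have hr0 : 0 ≤ r := by positivity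
    set ζ : Module.Dual ℝ A → H := fun α => S.rootProj α (y - x) with hζ
    have hshort : ∀ γ ∈ S.roots, ‖S.phi (-(v + r • e γ)) (ζ γ)‖ ≤ 1 := fun γ hγ =>
      hclimb γ hγ _ (he γ hγ).1 (he γ hγ).2 b r hb le_rfl v _ (S.rootProj_mem γ _) (hxy γ hγ)
    refine ⟨v + r • e α, ?_, Or.inr ⟨e α, (he α hα).1,
      S.forall_exists_eq_smul (he α hα).1 fun β hβ => ?_⟩⟩
    · set T := S.roots.erase α with hT
      have hTs : T ⊆ S.roots := Finset.erase_subset _ _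
      have hcard : (T.card : ℝ) = N - 1 := by
        have h1 := Finset.card_erase_add_one hα
        rw [hN, ← h1]; push_cast; ring
      have hsum : y = x + ∑ γ ∈ T, ζ γ + ζ α := by
        have h1 : ζ α + ∑ γ ∈ T, ζ γ = y - x := by
          rw [Finset.add_sum_erase _ _ hα]
          exact S.sum_rootProj _
        rw [add_assoc, add_comm _ (ζ α), h1, add_sub_cancel]
      have d1 := S.rdist_loops_le (v := v) hr0 (e := e) (ζ := ζ) T
        (fun γ hγ => (he γ (hTs hγ)).1) (fun γ hγ => hshort γ (hTs hγ)) x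
      have d2 := S.rdist_ver_le (x + ∑ γ ∈ T, ζ γ) v (v + r • e α)
      have d3 := S.rdist_hor_le (x + ∑ γ ∈ T, ζ γ) (x + ∑ γ ∈ T, ζ γ + ζ α) (v + r • e α)
      rw [add_sub_cancel_left, norm_smul, (he α hα).1, Real.norm_of_nonneg hr0, mul_one] at d2
      rw [add_sub_cancel_left, ← hsum] at d3
      have d3' := d3.trans (hshort α hα)
      rw [hcard] at d1
      have t1 := S.rdist_triangle ⟨x, v⟩ ⟨x + ∑ γ ∈ T, ζ γ, v⟩ ⟨y, v + r • e α⟩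
      have t2 := S.rdist_triangle ⟨x + ∑ γ ∈ T, ζ γ, v⟩ ⟨x + ∑ γ ∈ T, ζ γ, v + r • e α⟩
        ⟨y, v + r • e α⟩
      refine le_trans ?_ (mul_climb_le hN1 one_pos hb (by linarith : (0 : ℝ) ≤ K))
      rw [← hr]
      linarith
    · by_cases hβα : α = β
      · exact ⟨dualNorm β, by rw [hβα]; exact (he β hβ).2⟩
      · refine ⟨-dualNorm β, fun w => ?_⟩
        rw [(he β hβ).2, hpair α hα β hβ hβα, inner_neg_left]
        ring

end SplitAbelianByAbelian

namespace SplitAbelianByAbelian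

/-! ### Quasi-geodesics -/

section Steps

theorem abs_min_add_one_sub_min_le (j T : ℝ) : |min j T - min (j + 1) T| ≤ 1 := by
  rcases le_total j T with h | h <;> rcases le_total (j + 1) T with h' | h' <;>
    simp only [min_eq_left, min_eq_right, h, h'] <;> rw [abs_le] <;> constructor <;> linarith

/-- The points at distance `0, 1, 2, …` from `s₁` on the way from `s₁` to `s₂`. -/
theorem exists_unit_steps (s₁ s₂ : ℝ) : ∃ τ : ℕ → ℝ, τ 0 = s₁ ∧ τ ⌈|s₂ - s₁|⌉₊ = s₂ ∧
    (∀ j, τ j ∈ uIcc s₁ s₂) ∧ (∀ j, |τ j - τ (j + 1)| ≤ 1) ∧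
    ∀ j < ⌈|s₂ - s₁|⌉₊, |τ j - s₁| = j := by
  obtain ⟨θ, hθ, hT⟩ : ∃ θ : ℝ, |θ| = 1 ∧ s₂ = s₁ + θ * |s₂ - s₁| := by
    rcases le_total 0 (s₂ - s₁) with h | h
    · exact ⟨1, by simp, by rw [abs_of_nonneg h]; ring⟩
    · exact ⟨-1, by simp, by rw [abs_of_nonpos h]; ring⟩
  set T := |s₂ - s₁| with hTdef
  have hT0 : 0 ≤ T := abs_nonneg _
  refine ⟨fun j => s₁ + θ * min (j : ℝ) T, by simp [hT0], ?_, fun j => ?_, fun j => ?_,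
    fun j hj => ?_⟩
  · simp only [min_eq_right (Nat.le_ceil T)]
    exact hT.symm
  · have h0 : 0 ≤ min (j : ℝ) T := le_min (Nat.cast_nonneg j) hT0
    have h1 := min_le_right (j : ℝ) T
    rcases abs_eq (zero_le_one' ℝ) |>.1 hθ with h | h <;> subst h
    · rw [uIcc_of_le (by linarith)]
      exact ⟨by linarith, by linarith⟩
    · rw [uIcc_of_ge (by linarith)]
      exact ⟨by linarith, by linarith⟩
  · have e : s₁ + θ * min (j : ℝ) T - (s₁ + θ * min ((j + 1 : ℕ) : ℝ) T) =
        θ * (min (j : ℝ) T - min ((j : ℝ) + 1) T) := by push_cast; ring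
    rw [e, abs_mul, hθ, one_mul]
    exact abs_min_add_one_sub_min_le _ _
  · have h1 : (j : ℝ) ≤ T := (Nat.lt_ceil.1 hj).le
    simp only [min_eq_left h1]
    rw [add_sub_cancel_left, abs_mul, hθ, one_mul, abs_of_nonneg (Nat.cast_nonneg j)]

end Steps

variable {H A : Type*} [NormedAddCommGroup H] [InnerProductSpace ℝ H]
  [NormedAddCommGroup A] [InnerProductSpace ℝ A]

theorem IsQuasiGeodesic.rdist_le {S : SplitAbelianByAbelian H A} {κ C L : ℝ} {lam : ℝ → S.Point}
    (h : S.IsQuasiGeodesic κ C L lam) {s t : ℝ} (hs : s ∈ Icc 0 L) (ht : t ∈ Icc 0 L) :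
    S.rdist (lam s) (lam t) ≤ κ * |s - t| + C := (h.2.2 s hs t ht).2

theorem IsQuasiGeodesic.abs_sub_le {S : SplitAbelianByAbelian H A} {κ C L : ℝ}
    {lam : ℝ → S.Point} (h : S.IsQuasiGeodesic κ C L lam) (hκ : 1 ≤ κ) {s t : ℝ}
    (hs : s ∈ Icc 0 L) (ht : t ∈ Icc 0 L) : |s - t| ≤ κ * (S.rdist (lam s) (lam t) + C) := by
  have h1 := (h.2.2 s hs t ht).1
  rw [← div_le_iff₀' (by linarith)]
  linarith

variable [FiniteDimensional ℝ H] [FiniteDimensional ℝ A]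

theorem IsQuasiGeodesic.norm_ver_sub_le {S : SplitAbelianByAbelian H A} {κ C L : ℝ}
    {lam : ℝ → S.Point} (h : S.IsQuasiGeodesic κ C L lam) {s t : ℝ}
    (hs : s ∈ Icc 0 L) (ht : t ∈ Icc 0 L) : ‖(lam t).ver - (lam s).ver‖ ≤ κ * |s - t| + C :=
  (S.norm_ver_sub_le_rdist _ _).trans (h.rdist_le hs ht)

theorem exists_norm_step_le (S : SplitAbelianByAbelian H A) {κ C : ℝ} (hκ : 1 ≤ κ) (hC : 0 ≤ C) :
    ∃ M : ℝ, 1 ≤ M ∧ ∀ (L : ℝ) (lam : ℝ → S.Point), S.IsQuasiGeodesic κ C L lam →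
      ∀ s ∈ Icc 0 L, ∀ t ∈ Icc 0 L, |s - t| ≤ 1 → ∀ α ∈ S.roots,
        ‖S.phi (-(lam s).ver) (S.rootProj α ((lam t).hor - (lam s).hor))‖ ≤ M := by
  obtain ⟨K, n, hK, hlow⟩ := S.exists_norm_phi_rootProj_le
  obtain ⟨R, hR, hRα⟩ := S.exists_dualNorm_le
  refine ⟨K * (1 + (κ + C)) ^ n * Real.exp (R * (κ + C)), ?_, fun L lam hq s hs t ht hst α hα => ?_⟩
  · have h1 : (1 : ℝ) ≤ (1 + (κ + C)) ^ n := one_le_pow₀ (by linarith)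
    have h2 : 1 ≤ Real.exp (R * (κ + C)) := Real.one_le_exp (by positivity)
    nlinarith [mul_le_mul hK h1 zero_le_one (by linarith)]
  · refine (hlow α hα _ _).trans ?_
    have h1 : S.rdist (lam s) (lam t) ≤ κ + C := (hq.rdist_le hs ht).trans (by nlinarith)
    have h2 := S.norm_ver_sub_le_rdist (lam s) (lam t)
    have h3 := S.rdist_nonneg (lam s) (lam t)
    have h4 := dualNorm_nonneg α
    have h5 := hRα α hα
    gcongr
    linarith

/-- Along a quasi-geodesic, horizontal displacements are bounded by summing up, over times at unit
distance from one another, what a step of bounded size at that time contributes in the frame of the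
starting point. -/
theorem exists_norm_displacement_le (S : SplitAbelianByAbelian H A) {κ C : ℝ} (hκ : 1 ≤ κ)
    (hC : 0 ≤ C) : ∃ K : ℝ, ∃ n : ℕ, 1 ≤ K ∧ ∀ (L : ℝ) (lam : ℝ → S.Point),
      S.IsQuasiGeodesic κ C L lam → ∀ α ∈ S.roots, ∀ s₁ ∈ Icc 0 L, ∀ s₂ ∈ Icc 0 L, ∀ B : ℕ → ℝ,
      (∀ (j : ℕ), ∀ r ∈ uIcc s₁ s₂, |r - s₁| = j → (1 + ‖(lam r).ver - (lam s₁).ver‖) ^ n *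
        Real.exp (α ((lam r).ver - (lam s₁).ver)) ≤ B j) →
      ‖S.phi (-(lam s₁).ver) (S.rootProj α ((lam s₂).hor - (lam s₁).hor))‖ ≤
        K * ∑ j ∈ Finset.range ⌈|s₂ - s₁|⌉₊, B j := by
  obtain ⟨M, hM, hstep⟩ := S.exists_norm_step_le hκ hC
  obtain ⟨K, n, hK, hphi⟩ := S.exists_norm_phi_le
  refine ⟨K * M, n, by nlinarith, fun L lam hq α hα s₁ hs₁ s₂ hs₂ B hB => ?_⟩
  obtain ⟨τ, hτ0, hτN, hτm, hτs, hτd⟩ := exists_unit_steps s₁ s₂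
  have hmem : ∀ j, τ j ∈ Icc 0 L := fun j => uIcc_subset_Icc hs₁ hs₂ (hτm j)
  suffices h : ∀ N ≤ ⌈|s₂ - s₁|⌉₊,
      ‖S.phi (-(lam s₁).ver) (S.rootProj α ((lam (τ N)).hor - (lam s₁).hor))‖ ≤
        K * M * ∑ j ∈ Finset.range N, B j by
    have := h _ le_rfl
    rwa [hτN] at this
  intro N
  induction N with
  | zero => intro _; simp [hτ0]
  | succ N ih =>
    intro hN
    have h1 := ih (by omega)
    have h2 : ‖S.phi (-(lam s₁).ver) (S.rootProj α ((lam (τ (N + 1))).hor - (lam (τ N)).hor))‖ ≤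
        K * M * B N := by
      have e : S.phi (-(lam s₁).ver) (S.rootProj α ((lam (τ (N + 1))).hor - (lam (τ N)).hor)) =
          S.phi ((lam (τ N)).ver - (lam s₁).ver)
            (S.phi (-(lam (τ N)).ver)
              (S.rootProj α ((lam (τ (N + 1))).hor - (lam (τ N)).hor))) := by
        rw [← S.phi_add_apply]; congr 2; abel
      rw [e]
      refine (hphi α hα _ (S.phi_mem_rootSpace _ (S.rootProj_mem α _)) _).trans ?_
      have h3 := hstep L lam hq _ (hmem N) _ (hmem (N + 1)) (hτs N) α hα
      have h4 := hB N (τ N) (hτm N) (hτd N (by omega))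
      have h5 : 0 ≤ (1 + ‖(lam (τ N)).ver - (lam s₁).ver‖) ^ n *
        Real.exp (α ((lam (τ N)).ver - (lam s₁).ver)) := by positivity
      calc _ = K * ((1 + ‖(lam (τ N)).ver - (lam s₁).ver‖) ^ n *
            Real.exp (α ((lam (τ N)).ver - (lam s₁).ver))) * _ := by rw [mul_assoc K]
        _ ≤ K * B N * M := by
          have h6 : 0 ≤ K * B N := mul_nonneg (by linarith) (h5.trans h4)
          gcongr
        _ = K * M * B N := by ring
    rw [Finset.sum_range_succ, mul_add]
    refine le_trans ?_ (add_le_add h1 h2)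
    rw [← sub_add_sub_cancel (lam (τ (N + 1))).hor (lam (τ N)).hor, map_add, map_add, add_comm]
    exact norm_add_le _ _

theorem mul_log_one_add_le {K T : ℝ} (hK : 0 < K) (hT : 0 ≤ T) :
    K * Real.log (1 + T) ≤ (1 + T) / 2 + K * Real.log (2 * K) := by
  have h1 := Real.log_le_sub_one_of_pos (show 0 < (1 + T) / (2 * K) by positivity)
  rw [Real.log_div (by positivity) (by positivity)] at h1
  have h2 : K * ((1 + T) / (2 * K)) = (1 + T) / 2 := by field_simp
  nlinarith

/-- A quasi-geodesic whose projection to `A` stays bounded is short: in a bounded region of `A`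
the horizontal displacement grows linearly with time, hence the distance only
logarithmically. -/
theorem exists_abs_sub_le_of_ver_bounded (S : SplitAbelianByAbelian H A) {κ C : ℝ} (hκ : 1 ≤ κ)
    (hC : 0 ≤ C) : ∃ K : ℝ, 1 ≤ K ∧ ∀ (L : ℝ) (lam : ℝ → S.Point),
      S.IsQuasiGeodesic κ C L lam → ∀ s₁ ∈ Icc 0 L, ∀ s₂ ∈ Icc 0 L, ∀ R : ℝ,
      (∀ r ∈ uIcc s₁ s₂, ‖(lam r).ver - (lam s₁).ver‖ ≤ R) → |s₂ - s₁| ≤ K * (R + 1) := by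
  obtain ⟨K₁, n, hK₁, hdisp⟩ := S.exists_norm_displacement_le hκ hC
  obtain ⟨K₂, hK₂, hlog⟩ := S.exists_rdist_le_log
  obtain ⟨R₀, hR₀, hRα⟩ := S.exists_dualNorm_le
  set N : ℝ := (S.roots.card : ℝ) with hN
  have hN0 : 0 ≤ N := Nat.cast_nonneg _
  set K₃ := Real.log (1 + N * K₁) with hK₃
  have hK₃0 : 0 ≤ K₃ := Real.log_nonneg (by have : 0 ≤ N * K₁ := by positivity
                                            linarith)
  set K₄ := κ * K₂ with hK₄
  have hK₄1 : 1 ≤ K₄ := by nlinarith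
  have hlK₄ : 0 ≤ Real.log (2 * K₄) := Real.log_nonneg (by linarith)
  refine ⟨2 * (κ * C + κ + K₄ * (1 + K₃ + n + R₀) + K₄ * Real.log (2 * K₄) + 1), ?_,
    fun L lam hq s₁ hs₁ s₂ hs₂ R hR => ?_⟩
  · have : 0 ≤ κ * C := by positivity
    have : 0 ≤ K₄ * (1 + K₃ + n + R₀) := by positivity
    have : 0 ≤ K₄ * Real.log (2 * K₄) := by positivity
    linarith
  set T := |s₂ - s₁| with hT
  have hT0 : 0 ≤ T := abs_nonneg _
  have hR0 : 0 ≤ R := (norm_nonneg _).trans (hR s₁ left_mem_uIcc)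
  have h1 : ∀ α ∈ S.roots,
      ‖S.phi (-(lam s₁).ver) (S.rootProj α ((lam s₂).hor - (lam s₁).hor))‖ ≤
        K₁ * ((1 + T) * ((1 + R) ^ n * Real.exp (R₀ * R))) := by
    intro α hα
    refine (hdisp L lam hq α hα s₁ hs₁ s₂ hs₂ (fun _ => (1 + R) ^ n * Real.exp (R₀ * R))
      fun j r hr _ => ?_).trans ?_
    · have h2 := hR r hr
      have h3 : α ((lam r).ver - (lam s₁).ver) ≤ R₀ * R :=
        (apply_le_dualNorm α _).trans
          (mul_le_mul (hRα α hα) h2 (norm_nonneg _) (by linarith))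
      gcongr
    · rw [Finset.sum_const, Finset.card_range, nsmul_eq_mul]
      gcongr
      have := Nat.ceil_lt_add_one hT0
      linarith
  set X := ‖S.phi (-(lam s₁).ver) ((lam s₂).hor - (lam s₁).hor)‖ with hX
  have h2 : X ≤ N * (K₁ * ((1 + T) * ((1 + R) ^ n * Real.exp (R₀ * R)))) := by
    rw [hX]
    conv_lhs => rw [← S.sum_rootProj ((lam s₂).hor - (lam s₁).hor), map_sum]
    refine (norm_sum_le _ _).trans ((Finset.sum_le_card_nsmul _ _ _ h1).trans ?_)
    rw [nsmul_eq_mul]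
  have hY1 : 1 ≤ (1 + T) * ((1 + R) ^ n * Real.exp (R₀ * R)) := by
    have a1 : 1 ≤ (1 + R) ^ n := one_le_pow₀ (by linarith)
    have a2 : 1 ≤ Real.exp (R₀ * R) := Real.one_le_exp (by positivity)
    have a3 : 1 ≤ (1 + R) ^ n * Real.exp (R₀ * R) := by nlinarith
    nlinarith
  have h3 : 1 + X ≤ (1 + N * K₁) * ((1 + T) * ((1 + R) ^ n * Real.exp (R₀ * R))) := by
    linarith
  have h4 : Real.log (1 + X) ≤ K₃ + (Real.log (1 + T) + (n * R + R₀ * R)) := by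
    have hX0 : 0 ≤ X := norm_nonneg _
    refine (Real.log_le_log (by linarith) h3).trans ?_
    rw [Real.log_mul (by positivity) (by positivity), Real.log_mul (by positivity) (by positivity),
      Real.log_mul (by positivity) (by positivity), Real.log_pow, Real.log_exp]
    have : Real.log (1 + R) ≤ R := by
      have := Real.log_le_sub_one_of_pos (show 0 < 1 + R by linarith)
      linarith
    gcongr
  have h5 := hlog (lam s₁).hor (lam s₂).hor (lam s₁).ver (lam s₂).ver
  have h6 := hR s₂ right_mem_uIcc
  have h7 := hq.abs_sub_le hκ hs₁ hs₂
  rw [abs_sub_comm, ← hT] at h7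
  have h8 := mul_log_one_add_le (show 0 < K₄ by linarith) hT0
  have h9 : S.rdist (lam s₁) (lam s₂) ≤
      R + K₂ * (1 + (K₃ + (Real.log (1 + T) + (n * R + R₀ * R)))) :=
    h5.trans (add_le_add h6 (by gcongr))
  have h10 : T ≤ κ * (R + K₂ * (1 + (K₃ + (Real.log (1 + T) + (n * R + R₀ * R)))) + C) :=
    h7.trans (by gcongr)
  have h11 : T ≤ κ * R + κ * C + K₄ * (1 + K₃ + (n + R₀) * R) + K₄ * Real.log (1 + T) := by
    rw [hK₄]; linarith
  have h12 : T ≤ 2 * (κ * R + κ * C + K₄ * (1 + K₃ + (n + R₀) * R) +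
      K₄ * Real.log (2 * K₄)) + 1 := by linarith
  refine h12.trans ?_
  have b1 : 0 ≤ κ * C * R := by positivity
  have b2 : 0 ≤ K₄ * (1 + K₃) * R := by positivity
  have b3 : 0 ≤ K₄ * (n + R₀) := by positivity
  have b4 : 0 ≤ K₄ * Real.log (2 * K₄) * R := by positivity
  nlinarith

end SplitAbelianByAbelian

namespace SplitAbelianByAbelian

/-! ### Projection to a segment -/

section Segment

variable {A : Type*} [NormedAddCommGroup A] [InnerProductSpace ℝ A]

/-- The unit vector pointing from `a` to `b`. -/
noncomputable def segDir (a b : A) : A := ‖b - a‖⁻¹ • (b - a)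

/-- The arclength parameter, measured from `a`, of the closest point projection of `v` to the
segment `[a, b]`. -/
noncomputable def segParam (a b v : A) : ℝ := max 0 (min ‖b - a‖ (inner ℝ (segDir a b) (v - a)))

theorem norm_segDir {a b : A} (hab : a ≠ b) : ‖segDir a b‖ = 1 := by
  have : ‖b - a‖ ≠ 0 := norm_ne_zero_iff.2 (sub_ne_zero.2 hab.symm)
  rw [segDir, norm_smul, norm_inv, norm_norm, inv_mul_cancel₀ this]

theorem segParam_nonneg (a b v : A) : 0 ≤ segParam a b v := le_max_left _ _

theorem segParam_le (a b v : A) : segParam a b v ≤ ‖b - a‖ :=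
  max_le (norm_nonneg _) (min_le_left _ _)

theorem abs_segParam_sub_le {a b : A} (hab : a ≠ b) (v w : A) :
    |segParam a b v - segParam a b w| ≤ ‖v - w‖ := by
  refine (abs_max_sub_max_le_max _ _ _ _).trans (max_le (by simp) ?_)
  refine (abs_min_sub_min_le_max _ _ _ _).trans (max_le (by simp) ?_)
  rw [← inner_sub_right, sub_sub_sub_cancel_right]
  simpa [norm_segDir hab] using abs_real_inner_le_norm (segDir a b) (v - w)

theorem continuous_segParam (a b : A) : Continuous (segParam a b) := by
  unfold segParam
  fun_prop

theorem mem_segment_iff_segDir {a b z : A} (hab : a ≠ b) :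
    z ∈ segment ℝ a b ↔ ∃ r ∈ Icc 0 ‖b - a‖, z = a + r • segDir a b := by
  have h0 : 0 < ‖b - a‖ := norm_pos_iff.2 (sub_ne_zero.2 hab.symm)
  rw [segment_eq_image']
  constructor
  · rintro ⟨θ, hθ, rfl⟩
    refine ⟨θ * ‖b - a‖, ⟨mul_nonneg hθ.1 h0.le, mul_le_of_le_one_left h0.le hθ.2⟩, ?_⟩
    rw [segDir, smul_smul, mul_assoc, mul_inv_cancel₀ h0.ne', mul_one]
  · rintro ⟨r, hr, rfl⟩
    refine ⟨r / ‖b - a‖, ⟨div_nonneg hr.1 h0.le, (div_le_one h0).2 hr.2⟩, ?_⟩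
    simp only [segDir, smul_smul, div_eq_mul_inv]

theorem isCompact_segment (a b : A) : IsCompact (segment ℝ a b) := by
  rw [segment_eq_image']
  exact isCompact_Icc.image (by fun_prop)

theorem norm_sub_segParam_le {a b v z : A} (hab : a ≠ b) (hz : z ∈ segment ℝ a b) :
    ‖v - (a + segParam a b v • segDir a b)‖ ≤ ‖v - z‖ := by
  obtain ⟨r, hr, rfl⟩ := (mem_segment_iff_segDir hab).1 hz
  have key : ∀ s : ℝ, ‖v - (a + s • segDir a b)‖ ^ 2 =
      ‖v - a‖ ^ 2 - 2 * s * inner ℝ (segDir a b) (v - a) + s ^ 2 := by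
    intro s
    rw [← sub_sub, norm_sub_sq_real, norm_smul, norm_segDir hab, inner_smul_right,
      real_inner_comm, mul_one, Real.norm_eq_abs, sq_abs]
    ring
  refine le_of_sq_le_sq ?_ (norm_nonneg _)
  rw [key, key, segParam]
  set c := inner ℝ (segDir a b) (v - a)
  rcases le_total ‖b - a‖ c with h1 | h1
  · rw [min_eq_left h1, max_eq_right (norm_nonneg _)]
    nlinarith [hr.1, hr.2]
  · rw [min_eq_right h1]
    rcases le_total 0 c with h2 | h2
    · rw [max_eq_right h2]
      nlinarith [sq_nonneg (c - r)]
    · rw [max_eq_left h2]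
      nlinarith [hr.1]

theorem segParam_mem_segment {a b : A} (hab : a ≠ b) (v : A) :
    a + segParam a b v • segDir a b ∈ segment ℝ a b :=
  (mem_segment_iff_segDir hab).2 ⟨_, ⟨segParam_nonneg a b v, segParam_le a b v⟩, rfl⟩

theorem dist_segParam_eq_infDist {a b : A} (hab : a ≠ b) (v : A) :
    dist v (a + segParam a b v • segDir a b) = Metric.infDist v (segment ℝ a b) := by
  refine le_antisymm ((Metric.le_infDist ⟨a, left_mem_segment ℝ a b⟩).2 fun {z} hz => ?_)
    (Metric.infDist_le_dist_of_mem (segParam_mem_segment hab v))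
  rw [dist_eq_norm, dist_eq_norm]
  exact norm_sub_segParam_le hab hz

theorem sameProj_of_segParam_eq {a b v w : A} (hab : a ≠ b)
    (h : segParam a b v = segParam a b w) : SameProj a b v w := by
  refine ⟨_, segParam_mem_segment hab v, dist_segParam_eq_infDist hab v, ?_⟩
  rw [h]
  exact dist_segParam_eq_infDist hab w

end Segment

variable {H A : Type*} [NormedAddCommGroup H] [InnerProductSpace ℝ H]
  [NormedAddCommGroup A] [InnerProductSpace ℝ A]

theorem NearSegment.exists_norm_sub_le {S : SplitAbelianByAbelian H A} {ε L : ℝ} {a b : A}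
    {lam : ℝ → S.Point} (h : S.NearSegment ε L a b lam)
    (hc : ContinuousOn (fun t => (lam t).ver) (Icc 0 L)) (hL : 0 ≤ L) :
    (∀ t ∈ Icc 0 L, ∃ z ∈ segment ℝ a b,
      ‖(lam t).ver - z‖ ≤ ε * ‖(lam L).ver - (lam 0).ver‖) ∧
    ∀ z ∈ segment ℝ a b, ∃ t ∈ Icc 0 L,
      ‖(lam t).ver - z‖ ≤ ε * ‖(lam L).ver - (lam 0).ver‖ := by
  obtain ⟨-, -, hd⟩ := h
  rw [dist_comm, dist_eq_norm] at hd
  set X := (fun t => (lam t).ver) '' Icc 0 L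
  have hX : IsCompact X := isCompact_Icc.image_of_continuousOn hc
  have hXn : X.Nonempty := ⟨_, 0, left_mem_Icc.2 hL, rfl⟩
  have hZ := isCompact_segment a b
  have hZn : (segment ℝ a b).Nonempty := ⟨a, left_mem_segment ℝ a b⟩
  have hfin : Metric.hausdorffEDist X (segment ℝ a b) ≠ ⊤ :=
    Metric.hausdorffEDist_ne_top_of_nonempty_of_bounded hXn hZn hX.isBounded hZ.isBounded
  constructor
  · intro t ht
    obtain ⟨z, hz, hzd⟩ := hZ.exists_infDist_eq_dist hZn (lam t).ver
    refine ⟨z, hz, ?_⟩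
    rw [← dist_eq_norm, ← hzd]
    exact (Metric.infDist_le_hausdorffDist_of_mem (mem_image_of_mem _ ht) hfin).trans hd
  · intro z hz
    obtain ⟨_, hy, htd⟩ := hX.exists_infDist_eq_dist hXn z
    obtain ⟨t, ht, rfl⟩ := hy
    refine ⟨t, ht, ?_⟩
    rw [← dist_eq_norm, dist_comm]
    refine le_trans (le_of_eq htd.symm) ?_
    rw [Metric.hausdorffEDist_comm] at hfin
    refine (Metric.infDist_le_hausdorffDist_of_mem hz hfin).trans ?_
    rwa [Metric.hausdorffDist_comm]

/-- The projection of the path `lam` to `A` follows a line up to an error `E`: the function `f`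
records the progress along the line, and `σ α` is the slope of the root `α` in its
direction. The slopes may be small, but are at least `1 / E`. -/
structure FollowsLine (S : SplitAbelianByAbelian H A) (lam : ℝ → S.Point) (L : ℝ) (f : ℝ → ℝ)
    (σ : Module.Dual ℝ A → ℝ) (E : ℝ) : Prop where
  continuousOn : ContinuousOn f (Icc 0 L)
  abs_sub_le : ∀ s ∈ Icc 0 L, ∀ t ∈ Icc 0 L, |f t - f s| ≤ ‖(lam t).ver - (lam s).ver‖
  norm_le : ∀ s ∈ Icc 0 L, ∀ t ∈ Icc 0 L, ‖(lam t).ver - (lam s).ver‖ ≤ |f t - f s| + E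
  slope : ∀ α ∈ S.roots, ∀ s ∈ Icc 0 L, ∀ t ∈ Icc 0 L,
    |α ((lam t).ver - (lam s).ver) - σ α * (f t - f s)| ≤ E
  steep : ∀ α ∈ S.roots, 1 ≤ |σ α| * E
  one_le : 1 ≤ E

theorem FollowsLine.neg {S : SplitAbelianByAbelian H A} {lam : ℝ → S.Point} {L E : ℝ} {f : ℝ → ℝ}
    {σ : Module.Dual ℝ A → ℝ} (h : S.FollowsLine lam L f σ E) :
    S.FollowsLine lam L (-f) (-σ) E where
  continuousOn := h.continuousOn.neg
  abs_sub_le s hs t ht := by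
    simpa [← neg_add', abs_sub_comm, neg_add_eq_sub] using h.abs_sub_le s hs t ht
  norm_le s hs t ht := by
    have := h.norm_le s hs t ht
    rw [abs_sub_comm] at this
    simpa [neg_add_eq_sub] using this
  slope α hα s hs t ht := by
    have := h.slope α hα s hs t ht
    have e : (-σ) α * ((-f) t - (-f) s) = σ α * (f t - f s) := by
      simp only [Pi.neg_apply]; ring
    rwa [e]
  steep α hα := by simpa using h.steep α hα
  one_le := h.one_le

variable [FiniteDimensional ℝ H] [FiniteDimensional ℝ A]

/-- A point away from the walls has a definite slope with respect to each root. -/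
theorem mul_norm_le_abs_of_notMem_walls (S : SplitAbelianByAbelian H A) {p q : S.Point} {θ C : ℝ}
    (hθ : 0 < θ) (hθ1 : θ ≤ 1) (hC : 0 ≤ C)
    (h : q.ver ∉ linearNbhd dist (Point.ver '' S.walls p) p.ver θ C) {α : Module.Dual ℝ A}
    (hα : α ∈ S.roots) :
    dualNorm α * (θ / 2 * ‖q.ver - p.ver‖) ≤ |α (q.ver - p.ver)| ∧ 0 < ‖q.ver - p.ver‖ := by
  obtain ⟨e, he⟩ := S.exists_unit_gradients
  obtain ⟨he1, hein⟩ := he α hα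
  set Δ := q.ver - p.ver with hΔ
  set n := inner ℝ (e α) Δ with hn
  set w := Δ - n • e α with hw
  have hw0 : α w = 0 := by
    rw [hein, hw, inner_sub_right, inner_smul_right, real_inner_self_eq_norm_sq, he1, ← hn]
    ring
  have hmem : p.ver + w ∈ Point.ver '' S.walls p := ⟨p * S.ofA w, ⟨α, hα, w, hw0, rfl⟩, rfl⟩
  have h1 : ¬ dist q.ver (p.ver + w) ≤ θ * dist (p.ver + w) p.ver + C :=
    fun h' => h ⟨_, hmem, h'⟩
  have e1 : dist q.ver (p.ver + w) = |n| := by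
    rw [dist_eq_norm, ← sub_sub, ← hΔ, hw, sub_sub_cancel, norm_smul, he1, mul_one,
      Real.norm_eq_abs]
  have e2 : dist (p.ver + w) p.ver = ‖w‖ := by rw [dist_eq_norm, add_sub_cancel_left]
  rw [e1, e2, not_le] at h1
  have h2 : ‖Δ‖ ≤ ‖w‖ + |n| := by
    have : ‖w + n • e α‖ ≤ ‖w‖ + ‖n • e α‖ := norm_add_le _ _
    rwa [hw, sub_add_cancel, norm_smul, he1, mul_one, Real.norm_eq_abs] at this
  have hw' := norm_nonneg w
  have h3 : 0 < |n| := by nlinarith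
  constructor
  · have hα0 := dualNorm_nonneg α
    rw [hein Δ, abs_mul, abs_of_nonneg hα0]
    gcongr
    nlinarith
  · have hn0 : n ≠ 0 := abs_pos.1 h3
    refine norm_pos_iff.2 fun h0 => hn0 ?_
    rw [hn, h0, inner_zero_right]

theorem roots_nonempty_of_rdist_pos (S : SplitAbelianByAbelian H A) {p q : S.Point}
    (h : 0 < S.rdist p q) : S.roots.Nonempty := by
  by_contra hne
  rw [Finset.not_nonempty_iff_eq_empty] at hne
  have hx : ∀ x : H, x = 0 := fun x => by rw [← S.sum_rootProj x, hne, Finset.sum_empty]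
  have hA : ∀ z : A, z = 0 := fun z => by
    have h0 : (InnerProductSpace.toDual ℝ A z : A →L[ℝ] ℝ).toLinearMap ∈
        Submodule.span ℝ (S.roots : Set (Module.Dual ℝ A)) := S.span_roots ▸ Submodule.mem_top
    rw [hne, Finset.coe_empty, Submodule.span_empty, Submodule.mem_bot] at h0
    have h1 : inner ℝ z z = 0 := by
      simpa using congrArg (fun g : A →ₗ[ℝ] ℝ => g z) h0
    exact inner_self_eq_zero.1 h1
  have : p = q := Point.ext ((hx _).trans (hx _).symm) ((hA _).trans (hA _).symm)
  rw [this, S.rdist_self] at h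
  exact lt_irrefl _ h

set_option maxHeartbeats 800000 in
/-- The geometric input: a quasi-geodesic near a segment whose end point is away from the walls
follows a line with an error of the order of `(δ + ε) (|ab| + 1)`, and its duration is comparable
to the length of the segment. -/
theorem exists_followsLine (S : SplitAbelianByAbelian H A) {κ C : ℝ} (hκ : 1 ≤ κ) (hC : 0 ≤ C) :
    ∃ K : ℝ, 1 ≤ K ∧ ∀ (L : ℝ) (lam : ℝ → S.Point) (ε δ : ℝ) (a b : A), 0 ≤ L →
      S.IsQuasiGeodesic κ C L lam → 0 < δ → ε ≤ 1 / 4 → 3 ≤ δ * S.rdist (lam 0) (lam L) →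
      (lam L).ver ∉ linearNbhd dist (Point.ver '' S.walls (lam 0)) (lam 0).ver
        (3 / (δ * S.rdist (lam 0) (lam L))) C →
      S.NearSegment ε L a b lam →
      ∃ (f : ℝ → ℝ) (σ : Module.Dual ℝ A → ℝ),
        S.FollowsLine lam L f σ (K * ((δ + ε) * (dist a b + 1))) ∧
        (∀ s t, f s = f t → SameProj a b (lam s).ver (lam t).ver) ∧
        (∀ t ∈ Icc 0 L, ∃ z ∈ segment ℝ a b,
          ‖(lam t).ver - z‖ ≤ K * ((δ + ε) * (dist a b + 1))) ∧
        (∀ z ∈ segment ℝ a b, ∃ t ∈ Icc 0 L,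
          ‖(lam t).ver - z‖ ≤ K * ((δ + ε) * (dist a b + 1))) ∧
        L + 1 ≤ K * (dist a b + 1) ∧ dist a b + 1 ≤ K * (L + 1) := by
  obtain ⟨K₁, hK₁, hdeg⟩ := S.exists_abs_sub_le_of_ver_bounded hκ hC
  obtain ⟨R, hR, hRα⟩ := S.exists_dualNorm_le
  obtain ⟨c, hc, hc1, hcα⟩ := S.exists_le_dualNorm
  set K₂ := 2 * K₁ + 1 with hK₂
  set K := (κ + C) * K₂ / c + 8 * R + 2 * (κ + C) + K₂ with hK
  have hq0 : 0 ≤ (κ + C) * K₂ / c := by positivity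
  have hK1 : 1 ≤ K := by linarith
  refine ⟨K, hK1, fun L lam ε δ a b hL hq hδ hε hD hw hnear => ?_⟩
  set D := S.rdist (lam 0) (lam L) with hDdef
  have hmem0 : (0 : ℝ) ∈ Icc 0 L := left_mem_Icc.2 hL
  have hmemL : L ∈ Icc 0 L := right_mem_Icc.2 hL
  have hD0 : 0 < D := by
    by_contra h
    nlinarith
  obtain ⟨α₀, hα₀⟩ := S.roots_nonempty_of_rdist_pos hD0
  have hθ : 0 < 3 / (δ * D) := by positivity
  have hθ1 : 3 / (δ * D) ≤ 1 := (div_le_one (by positivity)).2 hD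
  set Δ := ‖(lam L).ver - (lam 0).ver‖ with hΔ
  have hΔ0 : 0 < Δ := (S.mul_norm_le_abs_of_notMem_walls hθ hθ1 hC hw hα₀).2
  have hε0 : 0 ≤ ε := hnear.1
  obtain ⟨hto, hfrom⟩ := hnear.exists_norm_sub_le hq.2.1 hL
  set ρ := ε * Δ with hρ
  have hρ0 : 0 ≤ ρ := by positivity
  have hρ4 : ρ ≤ Δ / 4 := by linarith [mul_le_mul_of_nonneg_right hε hΔ0.le]
  have hab : a ≠ b := by
    rintro rfl
    rw [segment_same] at hto
    obtain ⟨z, hz, h1⟩ := hto 0 hmem0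
    obtain ⟨z', hz', h2⟩ := hto L hmemL
    rw [mem_singleton_iff] at hz hz'
    rw [hz] at h1
    rw [hz'] at h2
    have := norm_sub_le ((lam L).ver - a) ((lam 0).ver - a)
    rw [sub_sub_sub_cancel_right] at this
    linarith
  set ℓ := dist a b with hℓ
  have hℓ' : ‖b - a‖ = ℓ := by rw [hℓ, dist_comm, dist_eq_norm]
  have hℓ0 : 0 ≤ ℓ := dist_nonneg
  set f : ℝ → ℝ := fun t => segParam a b (lam t).ver with hf
  set u := segDir a b with hu
  set x : ℝ → A := fun t => (lam t).ver - (a + f t • u) with hx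
  have hxρ : ∀ t ∈ Icc 0 L, ‖x t‖ ≤ ρ := fun t ht => by
    obtain ⟨z, hz, h1⟩ := hto t ht
    exact (norm_sub_segParam_le hab hz).trans h1
  have hdiff : ∀ s t, (lam t).ver - (lam s).ver = (f t - f s) • u + (x t - x s) := fun s t => by
    simp only [hx, sub_smul]; abel
  have hxx : ∀ s ∈ Icc 0 L, ∀ t ∈ Icc 0 L, ‖x t - x s‖ ≤ 2 * ρ := fun s hs t ht => by
    linarith [norm_sub_le (x t) (x s), hxρ s hs, hxρ t ht]
  have hnle : ∀ s ∈ Icc 0 L, ∀ t ∈ Icc 0 L,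
      ‖(lam t).ver - (lam s).ver‖ ≤ |f t - f s| + 2 * ρ := fun s hs t ht => by
    rw [hdiff]
    refine (norm_add_le _ _).trans (add_le_add (le_of_eq ?_) (hxx s hs t ht))
    rw [norm_smul, norm_segDir hab, mul_one, Real.norm_eq_abs]
  have hfl : ∀ s t, |f t - f s| ≤ ℓ := fun s t => by
    have h1 := segParam_nonneg a b (lam s).ver
    have h2 := segParam_nonneg a b (lam t).ver
    have h3 := segParam_le a b (lam s).ver
    have h4 := segParam_le a b (lam t).ver
    rw [hℓ'] at h3 h4
    rw [abs_le]
    constructor <;> simp only [hf] <;> linarith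
  have hΔℓ : Δ ≤ 2 * ℓ := by linarith [hnle 0 hmem0 L hmemL, hfl 0 L]
  have hρℓ : ρ ≤ 2 * (ε * ℓ) := by linarith [mul_le_mul_of_nonneg_left hΔℓ hε0]
  have hLK : L + 1 ≤ K₂ * (ℓ + 1) := by
    have h1 := hdeg L lam hq 0 hmem0 L hmemL (2 * ℓ) fun r hr => by
      rw [uIcc_of_le hL] at hr
      linarith [hnle 0 hmem0 r hr, hfl 0 r]
    rw [sub_zero, abs_of_nonneg hL] at h1
    rw [hK₂]; linarith
  have hDL : D ≤ (κ + C) * (L + 1) := by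
    have := hq.rdist_le hmem0 hmemL
    rw [zero_sub, abs_neg, abs_of_nonneg hL] at this
    linarith [mul_nonneg hC hL]
  have hDℓ : D ≤ (κ + C) * K₂ * (ℓ + 1) := by
    calc D ≤ (κ + C) * (L + 1) := hDL
      _ ≤ (κ + C) * (K₂ * (ℓ + 1)) := by gcongr
      _ = _ := by ring
  set E₀ := (δ + ε) * (ℓ + 1) with hE₀
  have hδE : δ * (ℓ + 1) ≤ E₀ := by rw [hE₀]; gcongr; linarith
  have hεE : ε * ℓ ≤ E₀ := by rw [hE₀]; gcongr <;> linarith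
  have hE₀0 : 0 ≤ E₀ := by positivity
  have hRK : 8 * R * E₀ ≤ K * E₀ := by gcongr; linarith
  have hρE2 : 2 * ρ ≤ K * E₀ := by
    have : 1 * E₀ ≤ R * E₀ := by gcongr
    linarith
  have hρE : ρ ≤ K * E₀ := by linarith
  have hDE : δ * D ≤ c * (K * E₀) := by
    have h1 : (κ + C) * K₂ = c * ((κ + C) * K₂ / c) := by field_simp
    calc δ * D ≤ δ * ((κ + C) * K₂ * (ℓ + 1)) := by gcongr
      _ = c * ((κ + C) * K₂ / c) * (δ * (ℓ + 1)) := by rw [← h1]; ring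
      _ ≤ c * K * E₀ := by gcongr; linarith
      _ = _ := by ring
  set F := f L - f 0 with hF
  have hFΔ : |F| ≤ Δ := by
    simpa [hF, hf] using abs_segParam_sub_le hab (lam L).ver (lam 0).ver
  have hΔF : Δ / 2 ≤ |F| := by linarith [hnle 0 hmem0 L hmemL]
  have hF0 : 0 < |F| := by linarith
  refine ⟨f, fun α => α ((lam L).ver - (lam 0).ver) / F, ⟨?_, ?_, ?_, ?_, ?_, ?_⟩,
    fun s t hst => sameProj_of_segParam_eq hab hst, ?_, ?_, ?_, ?_⟩
  · exact (continuous_segParam a b).comp_continuousOn hq.2.1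
  · exact fun s hs t ht => abs_segParam_sub_le hab _ _
  · intro s hs t ht
    exact (hnle s hs t ht).trans (by linarith)
  · intro α hα s hs t ht
    -- Compare both the increment of `α` and the slope with the slope in the exact direction `u`.
    have hlin : ∀ s ∈ Icc 0 L, ∀ t ∈ Icc 0 L,
        |α ((lam t).ver - (lam s).ver) - α u * (f t - f s)| ≤ R * (2 * ρ) := fun s hs t ht => by
      rw [hdiff, map_add, map_smul, smul_eq_mul,
        show (f t - f s) * α u + α (x t - x s) - α u * (f t - f s) = α (x t - x s) by ring]
      exact (abs_apply_le_dualNorm α _).trans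
        (mul_le_mul (hRα α hα) (hxx s hs t ht) (norm_nonneg _) (by linarith))
    have h1 := hlin s hs t ht
    have h2 := hlin 0 hmem0 L hmemL
    rw [← hF] at h2
    set y := α ((lam L).ver - (lam 0).ver) with hy
    have hF0' : F ≠ 0 := abs_pos.1 hF0
    have h3 : |(y / F - α u) * (f t - f s)| ≤ 4 * R * (ε * ℓ) := by
      have e1 : y / F - α u = (y - α u * F) / F := by field_simp
      rw [e1, abs_mul, abs_div]
      have h4 : |y - α u * F| / |F| ≤ 4 * R * ε := by
        rw [div_le_iff₀ hF0]
        calc |y - α u * F| ≤ R * (2 * ρ) := h2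
          _ = 4 * R * ε * (Δ / 2) := by rw [hρ]; ring
          _ ≤ _ := by gcongr
      calc _ ≤ 4 * R * ε * ℓ := by gcongr; exact hfl s t
        _ = _ := by ring
    have e2 : α ((lam t).ver - (lam s).ver) - y / F * (f t - f s) =
        (α ((lam t).ver - (lam s).ver) - α u * (f t - f s)) - (y / F - α u) * (f t - f s) := by
      ring
    rw [e2]
    refine (abs_sub _ _).trans ?_
    have h5 : R * (2 * ρ) ≤ 4 * R * (ε * ℓ) := by
      linarith [mul_le_mul_of_nonneg_left hρℓ (by linarith : 0 ≤ R)]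
    have h6 : 8 * R * (ε * ℓ) ≤ 8 * R * E₀ := by gcongr
    linarith
  · intro α hα
    have h1 := (S.mul_norm_le_abs_of_notMem_walls hθ hθ1 hC hw hα).1
    rw [← hΔ] at h1
    have h2 : c * (3 / (δ * D) / 2) ≤ |α ((lam L).ver - (lam 0).ver) / F| := by
      rw [abs_div, le_div_iff₀ hF0]
      refine le_trans ?_ h1
      have h3 := hcα α hα
      have h4 := dualNorm_nonneg α
      rw [mul_assoc]
      gcongr
    have h4 : 1 ≤ c * (3 / (δ * D) / 2) * (K * E₀) := by
      have h5 : 1 ≤ 3 / (δ * D) / 2 * (δ * D) := by field_simp; norm_num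
      calc 1 ≤ 3 / (δ * D) / 2 * (δ * D) := h5
        _ ≤ 3 / (δ * D) / 2 * (c * (K * E₀)) := by gcongr
        _ = _ := by ring
    exact h4.trans (by gcongr)
  · have h1 : c * (K * E₀) ≤ 1 * (K * E₀) := by gcongr
    linarith
  · intro t ht
    obtain ⟨z, hz, h⟩ := hto t ht
    exact ⟨z, hz, h.trans hρE⟩
  · intro z hz
    obtain ⟨t, ht, h⟩ := hfrom z hz
    exact ⟨t, ht, h.trans hρE⟩
  · refine hLK.trans ?_
    gcongr
    linarith
  · obtain ⟨s, hs, h1⟩ := hfrom a (left_mem_segment ℝ a b)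
    obtain ⟨t, ht, h2⟩ := hfrom b (right_mem_segment ℝ a b)
    have hst : ∀ s ∈ Icc 0 L, ∀ t ∈ Icc 0 L, ‖(lam t).ver - (lam s).ver‖ ≤ (κ + C) * (L + 1) := by
      intro s hs t ht
      refine (hq.norm_ver_sub_le hs ht).trans ?_
      have : |s - t| ≤ L := by
        rw [abs_le]; constructor <;> linarith [hs.1, hs.2, ht.1, ht.2]
      have h0 := mul_le_mul_of_nonneg_left this (by linarith : 0 ≤ κ)
      linarith [mul_nonneg hC hL]
    have h3 := hst s hs t ht
    have h4 := hst 0 hmem0 L hmemL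
    have h5 : ℓ ≤ ρ + (κ + C) * (L + 1) + ρ := by
      rw [← hℓ', show b - a = -((lam t).ver - b) + ((lam t).ver - (lam s).ver) +
        ((lam s).ver - a) by abel]
      refine (norm_add₃_le).trans ?_
      rw [norm_neg]
      linarith
    have h6 : (2 * (κ + C) + K₂) * (L + 1) ≤ K * (L + 1) := by gcongr; linarith
    have h7 : 1 * 1 ≤ K₂ * (L + 1) := by gcongr <;> linarith
    have h8 : 0 ≤ (κ + C) * (L + 1) := by positivity
    linarith

end SplitAbelianByAbelian

namespace SplitAbelianByAbelian

/-! ### Weakly monotone paths along a line -/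

section Real

/-- Between a time `t` and the time `t₀` of a minimum there is a time `s` at the level of `t`
after which, on the way to `t₀`, the path stays below this level. -/
theorem exists_last_time_at_level {f : ℝ → ℝ} {L t t₀ : ℝ} (hf : ContinuousOn f (Icc 0 L))
    (ht : t ∈ Icc 0 L) (ht₀ : t₀ ∈ Icc 0 L) (hmin : f t₀ ≤ f t) :
    ∃ s ∈ Icc 0 L, f s = f t ∧ ∀ r ∈ uIcc s t₀, f r ≤ f s := by
  have hsub : uIcc t t₀ ⊆ Icc 0 L := uIcc_subset_Icc ht ht₀
  have hZ : IsCompact (uIcc t t₀ ∩ f ⁻¹' {f t}) :=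
    isCompact_uIcc.of_isClosed_subset
      ((hf.mono hsub).preimage_isClosed_of_isClosed isClosed_Icc isClosed_singleton)
      inter_subset_left
  obtain ⟨s, ⟨hs, hst⟩, hsmin⟩ := hZ.exists_isMinOn ⟨t, left_mem_uIcc, rfl⟩
    (f := fun r => |r - t₀|) (by fun_prop)
  rw [mem_preimage, mem_singleton_iff] at hst
  refine ⟨s, hsub hs, hst, fun r hr => ?_⟩
  by_contra! hlt
  rw [hst] at hlt
  have hr' : r ∈ uIcc t t₀ := uIcc_subset_uIcc hs right_mem_uIcc hr
  have hsub' : uIcc r t₀ ⊆ uIcc t t₀ := uIcc_subset_uIcc hr' right_mem_uIcc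
  obtain ⟨r', hr'm, hr'f⟩ := intermediate_value_uIcc (hf.mono (hsub'.trans hsub))
    (show f t ∈ uIcc (f r) (f t₀) from ⟨by simp [hmin], by simp [hlt.le]⟩)
  have h1 : |s - t₀| ≤ |r' - t₀| := hsmin ⟨hsub' hr'm, hr'f⟩
  have h2 : r' = r := by
    rcases le_total s t₀ with h | h
    · rw [uIcc_of_le h] at hr
      rw [uIcc_of_le hr.2] at hr'm
      rw [abs_of_nonpos (by linarith), abs_of_nonpos (by linarith [hr'm.2])] at h1
      linarith [hr.1, hr'm.1]
    · rw [uIcc_of_ge h] at hr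
      rw [uIcc_of_ge hr.1] at hr'm
      rw [abs_of_nonneg (by linarith), abs_of_nonneg (by linarith [hr'm.1])] at h1
      linarith [hr.2, hr'm.2]
  rw [h2] at hr'f
  linarith

theorem sum_inv_sq_le_two (N : ℕ) : ∑ j ∈ Finset.range N, 1 / (1 + (j : ℝ)) ^ 2 ≤ 2 := by
  suffices h : ∑ j ∈ Finset.range N, 1 / (1 + (j : ℝ)) ^ 2 ≤ 2 - 1 / (N : ℝ) by
    have : (0 : ℝ) ≤ 1 / N := by positivity
    linarith
  induction N with
  | zero => simp
  | succ N ih =>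
    rw [Finset.sum_range_succ]
    rcases Nat.eq_zero_or_pos N with rfl | hN
    · norm_num
    · have hN' : (0 : ℝ) < N := by exact_mod_cast hN
      have : 1 / (1 + (N : ℝ)) ^ 2 ≤ 1 / N - 1 / (N + 1) := by
        rw [div_sub_div _ _ hN'.ne' (by positivity), div_le_div_iff₀ (by positivity) (by positivity)]
        nlinarith
      push_cast
      linarith

/-- The polynomial factor `(1 + y) ^ m` is absorbed by `exp (y / E)` at the cost of a power
of `E`. -/
theorem one_add_pow_le_mul_exp_div {m : ℕ} (hm : 1 ≤ m) {E y : ℝ} (hE : 1 ≤ E) (hy : 0 ≤ y) :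
    (1 + y) ^ m ≤ (m * E) ^ m * Real.exp (y / E) := by
  have hm' : (1 : ℝ) ≤ m := by exact_mod_cast hm
  have h1 : 1 + y ≤ m * E * Real.exp (y / E / m) := by
    have h2 := Real.add_one_le_exp (y / E / m)
    have h3 : m * E * (y / E / m + 1) = y + m * E := by field_simp
    have h4 : 1 ≤ m * E := by nlinarith
    calc 1 + y ≤ m * E * (y / E / m + 1) := by linarith
      _ ≤ _ := by gcongr
  calc (1 + y) ^ m ≤ (m * E * Real.exp (y / E / m)) ^ m := by gcongr
    _ = (m * E) ^ m * Real.exp (m * (y / E / m)) := by rw [mul_pow, Real.exp_nat_mul]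
    _ = _ := by congr 2; field_simp

end Real

variable {H A : Type*} [NormedAddCommGroup H] [InnerProductSpace ℝ H]
  [NormedAddCommGroup A] [InnerProductSpace ℝ A]

/-- The distance `η d(λ(t), λ(0)) + C₁` within which a weakly monotone path has to return at the
time `t` to an earlier point at the same level. -/
noncomputable def slack (S : SplitAbelianByAbelian H A) (lam : ℝ → S.Point) (η C₁ t : ℝ) : ℝ :=
  η * S.rdist (lam t) (lam 0) + C₁

/-- Weak monotonicity with respect to the level function `f`. -/
structure WeaklyMonotoneAlong (S : SplitAbelianByAbelian H A) (lam : ℝ → S.Point) (L : ℝ)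
    (f : ℝ → ℝ) (η C₁ : ℝ) : Prop where
  eta_nonneg : 0 ≤ η
  const_nonneg : 0 ≤ C₁
  rdist_le : ∀ s ∈ Icc 0 L, ∀ t ∈ Icc 0 L, s < t → f t = f s →
    S.rdist (lam t) (lam s) ≤ S.slack lam η C₁ t

theorem WeaklyMonotoneAlong.neg {S : SplitAbelianByAbelian H A} {lam : ℝ → S.Point} {L : ℝ}
    {f : ℝ → ℝ} {η C₁ : ℝ} (h : S.WeaklyMonotoneAlong lam L f η C₁) :
    S.WeaklyMonotoneAlong lam L (-f) η C₁ :=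
  ⟨h.1, h.2, fun s hs t ht hst hf => h.3 s hs t ht hst (neg_injective hf)⟩

theorem WeaklyMonotoneAlong.slack_nonneg {S : SplitAbelianByAbelian H A} {lam : ℝ → S.Point}
    {L : ℝ} {f : ℝ → ℝ} {η C₁ : ℝ} (h : S.WeaklyMonotoneAlong lam L f η C₁) (t : ℝ) :
    0 ≤ S.slack lam η C₁ t :=
  add_nonneg (mul_nonneg h.1 (S.rdist_nonneg _ _)) h.2

variable [FiniteDimensional ℝ H] [FiniteDimensional ℝ A]

theorem WeaklyMonotoneAlong.slack_le {S : SplitAbelianByAbelian H A} {lam : ℝ → S.Point}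
    {L : ℝ} {f : ℝ → ℝ} {η C₁ : ℝ} (h : S.WeaklyMonotoneAlong lam L f η C₁) (s t : ℝ) :
    S.slack lam η C₁ s ≤ S.slack lam η C₁ t + η * S.rdist (lam s) (lam t) := by
  have := mul_le_mul_of_nonneg_left (S.rdist_triangle (lam s) (lam t) (lam 0)) h.1
  unfold slack
  linarith

/-- On a stretch of time on which the level stays below that of the end point `s₁`, time is
bounded by the progress made: backtracking is limited by weak monotonicity, and
without progress a quasi-geodesic is short. -/
theorem exists_abs_sub_le_of_le (S : SplitAbelianByAbelian H A) {κ C : ℝ} (hκ : 1 ≤ κ)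
    (hC : 0 ≤ C) : ∃ K : ℝ, 1 ≤ K ∧ ∀ (L : ℝ) (lam : ℝ → S.Point) (f : ℝ → ℝ)
      (σ : Module.Dual ℝ A → ℝ) (E η C₁ : ℝ), S.IsQuasiGeodesic κ C L lam →
      S.FollowsLine lam L f σ E → S.WeaklyMonotoneAlong lam L f η C₁ → K * η ≤ 1 →
      ∀ s ∈ Icc 0 L, ∀ s₁ ∈ Icc 0 L, (∀ r ∈ uIcc s s₁, f r ≤ f s₁) →
        |s - s₁| ≤ K * (|f s - f s₁| + S.slack lam η C₁ s₁ + E) := by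
  obtain ⟨K₁, hK₁, hdeg⟩ := S.exists_abs_sub_le_of_ver_bounded hκ hC
  set K := 2 * K₁ * (κ ^ 3 + 2 * κ ^ 2 * C + C + 2) with hK
  have hκ3 : 1 ≤ κ ^ 3 := one_le_pow₀ hκ
  have hκ0 : 0 ≤ κ := by linarith
  have hin : 1 ≤ κ ^ 3 + 2 * κ ^ 2 * C + C + 2 := by
    have : 0 ≤ 2 * κ ^ 2 * C := by positivity
    linarith
  have hK2 : 2 * K₁ * 1 ≤ K := by rw [hK]; gcongr
  refine ⟨K, by linarith, fun L lam f σ E η C₁ hq hf hm hη s hs s₁ hs₁ hle => ?_⟩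
  set I := |s - s₁| with hI
  have hI0 : 0 ≤ I := abs_nonneg _
  set B := S.slack lam η C₁ s₁ with hB
  have hB0 : 0 ≤ B := hm.slack_nonneg s₁
  have hη0 := hm.eta_nonneg
  have hE := hf.one_le
  have hsub : uIcc s s₁ ⊆ Icc 0 L := uIcc_subset_Icc hs hs₁
  have hret' : ∀ u ∈ uIcc s s₁, ∀ w ∈ uIcc s s₁, w < u → f u = f w →
      S.rdist (lam u) (lam w) ≤ B + η * (κ * I + C) := by
    intro u hu w hw hwu huw
    refine (hm.rdist_le w (hsub hw) u (hsub hu) hwu huw).trans ((hm.slack_le u s₁).trans ?_)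
    have h1 := hq.rdist_le (hsub hu) hs₁
    have h2 : |u - s₁| ≤ I := by
      have := abs_sub_right_of_mem_uIcc hu
      rwa [abs_sub_comm s₁ u, abs_sub_comm s₁ s] at this
    gcongr
    exact h1.trans (by gcongr)
  have hret : ∀ u ∈ uIcc s s₁, ∀ w ∈ uIcc s s₁, f u = f w →
      S.rdist (lam u) (lam w) ≤ B + η * (κ * I + C) := by
    intro u hu w hw huw
    rcases lt_trichotomy w u with h | rfl | h
    · exact hret' u hu w hw h huw
    · rw [S.rdist_self]; positivity
    · rw [S.rdist_comm]; exact hret' w hw u hu h huw.symm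
  -- If the path descends below `f s` on the way to `s₁`, it passes this level once more. By weak
  -- monotonicity it does so soon after the time `s`; hence the descent is small.
  have hX : ∀ r ∈ uIcc s s₁,
      |f r - f s₁| ≤ |f s - f s₁| + (κ * (κ * (B + η * (κ * I + C) + C)) + C) := by
    intro r hr
    have h1 := hle r hr
    have h2 := hle s left_mem_uIcc
    rw [abs_of_nonpos (by linarith), abs_of_nonpos (by linarith)]
    rcases le_or_gt (f s) (f r) with h3 | h3
    · have : 0 ≤ κ * (κ * (B + η * (κ * I + C) + C)) + C := by positivity
      linarith
    · have hsub' : uIcc r s₁ ⊆ uIcc s s₁ := uIcc_subset_uIcc hr right_mem_uIcc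
      obtain ⟨r', hr', hfr'⟩ := intermediate_value_uIcc
        (hf.continuousOn.mono (hsub'.trans hsub))
        (show f s ∈ uIcc (f r) (f s₁) from ⟨by simp [h3.le], by simp [h2]⟩)
      have h4 := hret s left_mem_uIcc r' (hsub' hr') hfr'.symm
      have h5 := hq.abs_sub_le hκ hs (hsub (hsub' hr'))
      have h6 : |s - r| ≤ |s - r'| := by
        rcases le_total s s₁ with h | h
        · rw [uIcc_of_le h] at hr
          rw [uIcc_of_le hr.2] at hr'
          rw [abs_of_nonpos (by linarith [hr.1]), abs_of_nonpos (by linarith [hr.1, hr'.1])]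
          linarith [hr'.1]
        · rw [uIcc_of_ge h] at hr
          rw [uIcc_of_ge hr.1] at hr'
          rw [abs_of_nonneg (by linarith [hr.2]), abs_of_nonneg (by linarith [hr.2, hr'.2])]
          linarith [hr'.2]
      have h7 := (hf.abs_sub_le r (hsub hr) s hs).trans (hq.norm_ver_sub_le (hsub hr) hs)
      rw [abs_sub_comm r s] at h7
      have h8 : |s - r| ≤ κ * (B + η * (κ * I + C) + C) := h6.trans (h5.trans (by gcongr))
      have h9 : κ * |s - r| ≤ κ * (κ * (B + η * (κ * I + C) + C)) := by gcongr
      have h10 := le_abs_self (f s - f r)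
      linarith
  have h1 := hdeg L lam hq s₁ hs₁ s hs
    (|f s - f s₁| + (κ * (κ * (B + η * (κ * I + C) + C)) + C) + E) fun r hr => by
      rw [uIcc_comm] at hr
      exact (hf.norm_le s₁ hs₁ r (hsub hr)).trans (by linarith [hX r hr])
  rw [← hI] at h1
  set F := |f s - f s₁|
  have hF0 : 0 ≤ F := abs_nonneg _
  -- The choice of `K` makes the right hand side depend on `I` with a coefficient at most `1 / 2`.
  have hηI : K₁ * κ ^ 3 * (η * I) ≤ I / 2 := by
    have : 2 * K₁ * κ ^ 3 * η ≤ K * η := by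
      gcongr
      rw [hK]
      gcongr
      have : 0 ≤ κ ^ 2 * C := by positivity
      linarith
    have h2 : 2 * K₁ * κ ^ 3 * η ≤ 1 := this.trans hη
    linarith [mul_le_mul_of_nonneg_right h2 hI0]
  have hη1 : η ≤ 1 := by
    have : 1 * η ≤ K * η := by gcongr; linarith
    linarith
  have hηC : η * C ≤ C := mul_le_of_le_one_left hC hη1
  have h2 : I ≤ 2 * K₁ * (F + κ ^ 2 * B + (2 * κ ^ 2 * C + C + 1) + E) := by
    have h3 : κ ^ 2 * (η * C) ≤ κ ^ 2 * C := by gcongr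
    have h4 : K₁ * (κ ^ 2 * (η * C)) ≤ K₁ * (κ ^ 2 * C) := by gcongr
    linarith
  refine h2.trans ?_
  rw [hK, mul_assoc (2 * K₁)]
  gcongr
  have g1 : κ ^ 2 * B ≤ κ ^ 3 * B := by gcongr; norm_num
  have g2 : (2 * κ ^ 2 * C + C + 1) * 1 ≤ (2 * κ ^ 2 * C + C + 1) * E := by gcongr
  have g3 : 0 ≤ (κ ^ 3 - 1) * F := mul_nonneg (by linarith) hF0
  have g4 : 0 ≤ (2 * κ ^ 2 * C + C + 2) * F := by positivity
  have g5 : 0 ≤ (2 * κ ^ 2 * C + C + 2) * B := by positivity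
  have g6 : 0 ≤ κ ^ 3 * E := by positivity
  linarith

/-- For a root which increases along the line, the horizontal displacement accumulated below the
level of `s₁` is, up to a power of the slack, bounded in the frame at `s₁`: the contributions
decay exponentially with the depth below this level. -/
theorem exists_displacement_below_le (S : SplitAbelianByAbelian H A) {κ C : ℝ} (hκ : 1 ≤ κ)
    (hC : 0 ≤ C) : ∃ K : ℝ, ∃ m : ℕ, 1 ≤ K ∧ ∀ (L : ℝ) (lam : ℝ → S.Point) (f : ℝ → ℝ)
      (σ : Module.Dual ℝ A → ℝ) (E η C₁ : ℝ), S.IsQuasiGeodesic κ C L lam →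
      S.FollowsLine lam L f σ E → S.WeaklyMonotoneAlong lam L f η C₁ → K * η ≤ 1 →
      ∀ α ∈ S.roots, 0 ≤ σ α → ∀ s₁ ∈ Icc 0 L, ∀ s₂ ∈ Icc 0 L, (∀ r ∈ uIcc s₁ s₂, f r ≤ f s₁) →
        ‖S.phi (-(lam s₁).ver) (S.rootProj α ((lam s₂).hor - (lam s₁).hor))‖ ≤
          Real.exp (K * E) * (1 + S.slack lam η C₁ s₁) ^ m := by
  obtain ⟨K₀, n, hK₀, hdisp⟩ := S.exists_norm_displacement_le hκ hC
  obtain ⟨K₁, hK₁, htime⟩ := S.exists_abs_sub_le_of_le hκ hC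
  set m := n + 2 with hm
  have hm1 : 1 ≤ m := by omega
  set K₅ := K₀ * (2 * ((1 + (κ + C)) ^ n * (K₁ * m) ^ m)) with hK₅
  have hK₅0 : 0 ≤ K₅ := by positivity
  set K := K₁ + K₅ + (1 + 2 * m) with hK
  have hKK₁ : K₁ ≤ K := by have : (0 : ℝ) ≤ 1 + 2 * m := by positivity
                           linarith
  refine ⟨K, m, hK₁.trans hKK₁, fun L lam f σ E η C₁ hq hf hw hη α hα hσ s₁ hs₁ s₂ hs₂ hle => ?_⟩
  have hη' : K₁ * η ≤ 1 := (mul_le_mul_of_nonneg_right hKK₁ hw.eta_nonneg).trans hη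
  have hE := hf.one_le
  set B := S.slack lam η C₁ s₁ with hB
  have hB0 : 0 ≤ B := hw.slack_nonneg s₁
  have hσE : 1 ≤ σ α * E := by simpa [abs_of_nonneg hσ] using hf.steep α hα
  set Q := (1 + (κ + C)) ^ n * Real.exp E * ((K₁ * (1 + B + E)) ^ m * (m * E) ^ m) with hQ
  have hQ0 : 0 ≤ Q := by positivity
  have hsub : uIcc s₁ s₂ ⊆ Icc 0 L := uIcc_subset_Icc hs₁ hs₂
  -- At the time-distance `j` the depth `y` is at least linear in `j`, so that the factor
  -- `exp (-y / E)` due to the slope absorbs the power of `1 + j` and leaves a summable term.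
  have hterm : ∀ (j : ℕ), ∀ r ∈ uIcc s₁ s₂, |r - s₁| = j →
      (1 + ‖(lam r).ver - (lam s₁).ver‖) ^ n * Real.exp (α ((lam r).ver - (lam s₁).ver)) ≤
        Q * (1 / (1 + (j : ℝ)) ^ 2) := by
    intro j r hr hj
    have hr' := hsub hr
    set y := f s₁ - f r with hy
    have hy0 : 0 ≤ y := sub_nonneg.2 (hle r hr)
    have h1 : 1 + ‖(lam r).ver - (lam s₁).ver‖ ≤ (1 + (κ + C)) * (1 + j) := by
      have := hq.norm_ver_sub_le hs₁ hr'
      rw [abs_sub_comm, hj] at this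
      have : 0 ≤ C * j := by positivity
      have : (0 : ℝ) ≤ j := by positivity
      linarith
    have h2 : α ((lam r).ver - (lam s₁).ver) ≤ E + -(y / E) := by
      have h3 := (le_abs_self _).trans (hf.slope α hα s₁ hs₁ r hr')
      have h4 : y / E ≤ σ α * y := by
        rw [div_le_iff₀ (by linarith)]
        linarith [mul_le_mul_of_nonneg_right hσE hy0]
      have h5 : σ α * (f r - f s₁) = -(σ α * y) := by rw [hy]; ring
      linarith
    have h3 : 1 + (j : ℝ) ≤ K₁ * (1 + B + E) * (1 + y) := by
      have h4 := htime L lam f σ E η C₁ hq hf hw hη' r hr' s₁ hs₁ fun u hu =>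
        hle u (uIcc_subset_uIcc hr left_mem_uIcc hu)
      rw [hj, abs_sub_comm, ← hy, abs_of_nonneg hy0, ← hB] at h4
      have h5 : 0 ≤ K₁ * ((B + E) * y) := by positivity
      linarith
    have h4 : (1 + (j : ℝ)) ^ m ≤ (K₁ * (1 + B + E)) ^ m * (m * E) ^ m * Real.exp (y / E) := by
      calc (1 + (j : ℝ)) ^ m ≤ (K₁ * (1 + B + E) * (1 + y)) ^ m := by gcongr
        _ = (K₁ * (1 + B + E)) ^ m * (1 + y) ^ m := mul_pow _ _ _
        _ ≤ (K₁ * (1 + B + E)) ^ m * ((m * E) ^ m * Real.exp (y / E)) := by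
          gcongr; exact one_add_pow_le_mul_exp_div hm1 hE hy0
        _ = _ := by ring
    have h5 : (1 + (j : ℝ)) ^ n * Real.exp (-(y / E)) ≤
        (K₁ * (1 + B + E)) ^ m * (m * E) ^ m * (1 / (1 + (j : ℝ)) ^ 2) := by
      rw [mul_one_div, le_div_iff₀ (by positivity)]
      calc (1 + (j : ℝ)) ^ n * Real.exp (-(y / E)) * (1 + (j : ℝ)) ^ 2
          = (1 + (j : ℝ)) ^ m * Real.exp (-(y / E)) := by rw [hm, pow_add]; ring
        _ ≤ (K₁ * (1 + B + E)) ^ m * (m * E) ^ m * Real.exp (y / E) * Real.exp (-(y / E)) := by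
          gcongr
        _ = _ := by rw [mul_assoc _ (Real.exp (y / E)), ← Real.exp_add]; simp
    calc (1 + ‖(lam r).ver - (lam s₁).ver‖) ^ n * Real.exp (α ((lam r).ver - (lam s₁).ver))
        ≤ ((1 + (κ + C)) * (1 + j)) ^ n * Real.exp (E + -(y / E)) := by gcongr
      _ = (1 + (κ + C)) ^ n * Real.exp E * ((1 + (j : ℝ)) ^ n * Real.exp (-(y / E))) := by
        rw [mul_pow, Real.exp_add]; ring
      _ ≤ (1 + (κ + C)) ^ n * Real.exp E *
          ((K₁ * (1 + B + E)) ^ m * (m * E) ^ m * (1 / (1 + (j : ℝ)) ^ 2)) := by gcongr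
      _ = _ := by rw [hQ]; ring
  refine (hdisp L lam hq α hα s₁ hs₁ s₂ hs₂ _ hterm).trans ?_
  rw [← Finset.mul_sum]
  have hEe : E ≤ Real.exp E := by linarith [Real.add_one_le_exp E]
  have hEe1 : 1 + E ≤ Real.exp E := by linarith [Real.add_one_le_exp E]
  have hQle : Q ≤ (1 + (κ + C)) ^ n * (K₁ * m) ^ m * Real.exp ((1 + 2 * m) * E) * (1 + B) ^ m := by
    have h1 : 1 + B + E ≤ (1 + B) * Real.exp E := by
      calc 1 + B + E ≤ (1 + B) * (1 + E) := by linarith [mul_nonneg hB0 (by linarith : 0 ≤ E)]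
        _ ≤ _ := by gcongr
    calc Q ≤ (1 + (κ + C)) ^ n * Real.exp E *
          ((K₁ * ((1 + B) * Real.exp E)) ^ m * (m * Real.exp E) ^ m) := by rw [hQ]; gcongr
      _ = (1 + (κ + C)) ^ n * (K₁ * m) ^ m *
          (Real.exp E * (Real.exp E ^ m * Real.exp E ^ m)) * (1 + B) ^ m := by
        simp only [mul_pow]; ring
      _ = _ := by
        rw [← Real.exp_nat_mul, ← Real.exp_add, ← Real.exp_add]
        congr 3; ring
  calc K₀ * (Q * ∑ j ∈ Finset.range ⌈|s₂ - s₁|⌉₊, 1 / (1 + (j : ℝ)) ^ 2)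
      ≤ K₀ * (((1 + (κ + C)) ^ n * (K₁ * m) ^ m * Real.exp ((1 + 2 * m) * E) * (1 + B) ^ m) *
          2) := by
        gcongr
        exact sum_inv_sq_le_two _
    _ = K₅ * Real.exp ((1 + 2 * m) * E) * (1 + B) ^ m := by rw [hK₅]; ring
    _ ≤ Real.exp (K * E) * (1 + B) ^ m := by
        gcongr
        have h1 : K₅ ≤ Real.exp (K₅ * E) := by
          have h2 := Real.add_one_le_exp (K₅ * E)
          have h3 : K₅ * 1 ≤ K₅ * E := by gcongr
          linarith
        calc K₅ * Real.exp ((1 + 2 * m) * E)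
            ≤ Real.exp (K₅ * E) * Real.exp ((1 + 2 * m) * E) := by gcongr
          _ = Real.exp ((K₅ + (1 + 2 * m)) * E) := by rw [← Real.exp_add]; congr 1; ring
          _ ≤ Real.exp (K * E) := by gcongr; linarith

end SplitAbelianByAbelian

namespace SplitAbelianByAbelian

variable {H A : Type*} [NormedAddCommGroup H] [InnerProductSpace ℝ H] [FiniteDimensional ℝ H]
  [NormedAddCommGroup A] [InnerProductSpace ℝ A]

theorem mk_mem_geodSegment (S : SplitAbelianByAbelian H A) (x : H) {a b t : A} :
    (⟨x, t⟩ : S.Point) ∈ S.geodSegment ⟨x, 0⟩ a b ↔ t ∈ segment ℝ a b := by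
  have h : ∀ t : A, (⟨x, 0⟩ : S.Point) * S.ofA t = ⟨x, t⟩ := fun t =>
    Point.ext (by change x + S.phi 0 0 = x; simp) (zero_add t)
  unfold geodSegment
  simp [h]

theorem exists_eq_of_mem_geodSegment (S : SplitAbelianByAbelian H A) {x : H} {a b : A}
    {q : S.Point} (hq : q ∈ S.geodSegment ⟨x, 0⟩ a b) :
    ∃ t ∈ segment ℝ a b, q = ⟨x, t⟩ := by
  obtain ⟨t, ht, rfl⟩ := hq
  exact ⟨t, ht, Point.ext (by change x + S.phi 0 0 = x; simp) (zero_add t)⟩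

variable [FiniteDimensional ℝ A]

/-- Two points of a weakly monotone path at the same level are close, whichever comes first. -/
theorem WeaklyMonotoneAlong.rdist_le_of_eq {S : SplitAbelianByAbelian H A} {lam : ℝ → S.Point}
    {L : ℝ} {f : ℝ → ℝ} {η C₁ ω : ℝ} (h : S.WeaklyMonotoneAlong lam L f η C₁) (hω : 0 < ω)
    (hω1 : ω ≤ 1) (hη : 4 * η ≤ ω) {s t : ℝ} (hs : s ∈ Icc 0 L) (ht : t ∈ Icc 0 L)
    (hst : f s = f t) : S.rdist (lam t) (lam s) ≤ (1 + ω / 2) * S.slack lam η C₁ t := by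
  have hB := h.slack_nonneg t
  rcases lt_trichotomy s t with hlt | rfl | hlt
  · have h1 := h.rdist_le s hs t ht hlt hst.symm
    linarith [mul_nonneg hω.le hB]
  · rw [S.rdist_self]; positivity
  · have h1 := h.rdist_le t ht s hs hlt hst
    have h2 := h.slack_le s t
    rw [S.rdist_comm]
    set d := S.rdist (lam s) (lam t)
    have hd : 0 ≤ d := S.rdist_nonneg _ _
    set B := S.slack lam η C₁ t
    have h3 : (1 - ω / 4) * d ≤ B := by
      linarith [mul_le_mul_of_nonneg_right hη hd]
    have h4 : 1 * d ≤ ((1 + ω / 2) * (1 - ω / 4)) * d := by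
      gcongr
      nlinarith
    have h5 : (1 + ω / 2) * ((1 - ω / 4) * d) ≤ (1 + ω / 2) * B := by gcongr
    linarith

/-- A root which increases along the line is compared with its horizontal coordinate at the
lowest point of the path. -/
theorem exists_displacement_le_of_slope_nonneg (S : SplitAbelianByAbelian H A) {κ C ω : ℝ}
    (hκ : 1 ≤ κ) (hC : 0 ≤ C) (hω : 0 < ω) (hω1 : ω ≤ 1) :
    ∃ K : ℝ, 1 ≤ K ∧ ∀ (L : ℝ) (lam : ℝ → S.Point) (f : ℝ → ℝ)
      (σ : Module.Dual ℝ A → ℝ) (E η C₁ : ℝ), 0 ≤ L → S.IsQuasiGeodesic κ C L lam →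
      S.FollowsLine lam L f σ E → S.WeaklyMonotoneAlong lam L f η C₁ → K * η ≤ 1 →
      ∀ α ∈ S.roots, 0 ≤ σ α → ∃ t₀ ∈ Icc 0 L, ∀ t ∈ Icc 0 L,
        ‖S.phi (-(lam t).ver) (S.rootProj α ((lam t₀).hor - (lam t).hor))‖ ≤
          Real.exp (dualNorm α * ((1 + ω) * S.slack lam η C₁ t / 2 + K * E)) := by
  obtain ⟨K₁, n₁, hK₁, hlow⟩ := S.exists_norm_phi_rootProj_le
  obtain ⟨K₂, n₂, hK₂, hphi⟩ := S.exists_norm_phi_le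
  obtain ⟨K₃, m, hK₃, hdisp⟩ := S.exists_displacement_below_le hκ hC
  obtain ⟨R, hR, hRα⟩ := S.exists_dualNorm_le
  obtain ⟨c, hc, hc1, hcα⟩ := S.exists_le_dualNorm
  obtain ⟨P₁, hP₁, hpow₁⟩ := exists_one_add_pow_le_exp n₁ (show 0 < c * ω / 8 by positivity)
  obtain ⟨P₂, hP₂, hpow₂⟩ := exists_one_add_pow_le_exp m (show 0 < c / 6 by positivity)
  obtain ⟨P₃, hP₃, hpow₃⟩ := exists_one_add_pow_le_exp n₂ (one_pos (α := ℝ))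
  set K₇ := K₁ * P₁ + K₂ * P₂ * P₃ with hK₇
  set K₈ := 1 + R + K₃ with hK₈
  set K := K₃ + 4 / ω + (K₇ + K₈) / c with hK
  have hK₇0 : 0 ≤ K₇ := by positivity
  have hK₈0 : 0 ≤ K₈ := by positivity
  have hq0 : 0 ≤ (K₇ + K₈) / c := by positivity
  have hω0 : 0 ≤ 4 / ω := by positivity
  refine ⟨K, by linarith, fun L lam f σ E η C₁ hL hq hf hw hη α hα hσ => ?_⟩
  have hη0 := hw.eta_nonneg
  have hη3 : K₃ * η ≤ 1 := (mul_le_mul_of_nonneg_right (by linarith) hη0).trans hη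
  have hη4 : 4 * η ≤ ω := by
    have h1 : 4 / ω * η ≤ 1 := (mul_le_mul_of_nonneg_right (by linarith) hη0).trans hη
    rw [div_mul_eq_mul_div, div_le_one hω] at h1
    exact h1
  have hη1 : η ≤ 1 := by linarith
  have hE := hf.one_le
  have hcα' := hcα α hα
  have hRα' := hRα α hα
  have hα0 := dualNorm_nonneg α
  obtain ⟨t₀, ht₀, hmin⟩ := isCompact_Icc.exists_isMinOn (nonempty_Icc.2 hL) hf.continuousOn
  refine ⟨t₀, ht₀, fun t ht => ?_⟩
  obtain ⟨s, hs, hst, hbelow⟩ := exists_last_time_at_level hf.continuousOn ht ht₀ (hmin ht)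
  set B := S.slack lam η C₁ t with hB
  have hB0 : 0 ≤ B := hw.slack_nonneg t
  have hd := hw.rdist_le_of_eq hω hω1 hη4 hs ht hst
  rw [← hB] at hd
  set d := S.rdist (lam t) (lam s) with hddef
  have hd0 : 0 ≤ d := S.rdist_nonneg _ _
  have hd2 : d ≤ 2 * B := hd.trans (by gcongr; linarith)
  have hver : ‖(lam s).ver - (lam t).ver‖ ≤ E := by
    simpa [hst] using hf.norm_le t ht s hs
  have hBs : S.slack lam η C₁ s ≤ 3 * B := by
    have h1 := hw.slack_le s t
    rw [S.rdist_comm] at h1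
    have h2 : η * d ≤ 1 * d := by gcongr
    linarith
  have hBs0 := hw.slack_nonneg s
  -- The displacement between the two points at the same level is bounded by their distance,
  have hfirst : ‖S.phi (-(lam t).ver) (S.rootProj α ((lam s).hor - (lam t).hor))‖ ≤
      K₁ * P₁ * Real.exp (dualNorm α * ((1 + ω) * B / 2)) * Real.exp (K₈ * E) := by
    refine (hlow α hα (lam t) (lam s)).trans ?_
    rw [← hddef]
    calc K₁ * (1 + d) ^ n₁ * Real.exp (dualNorm α * ((d + ‖(lam s).ver - (lam t).ver‖) / 2))
        ≤ K₁ * (P₁ * Real.exp (c * ω / 8 * d)) * Real.exp (dualNorm α * ((d + E) / 2)) := by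
          gcongr
          exact hpow₁ d hd0
      _ = K₁ * P₁ * Real.exp (c * ω / 8 * d + dualNorm α * ((d + E) / 2)) := by
          rw [Real.exp_add]; ring
      _ ≤ K₁ * P₁ * Real.exp (dualNorm α * ((1 + ω) * B / 2) + K₈ * E) := by
          refine mul_le_mul_of_nonneg_left (Real.exp_le_exp.2 ?_) (by positivity)
          have e1 : c * ω / 8 * d ≤ dualNorm α * ω / 8 * (2 * B) := by gcongr
          have e2 : dualNorm α * d ≤ dualNorm α * ((1 + ω / 2) * B) := by gcongr
          have e3 : dualNorm α * E ≤ R * E := by gcongr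
          have e4 : 0 ≤ (1 + K₃ + R / 2) * E := by positivity
          rw [hK₈]
          linarith
      _ = _ := by rw [Real.exp_add]; ring
  -- and the displacement accumulated below this level by the power of the slack.
  have hsecond : ‖S.phi (-(lam t).ver) (S.rootProj α ((lam t₀).hor - (lam s).hor))‖ ≤
      K₂ * P₂ * P₃ * Real.exp (dualNorm α * ((1 + ω) * B / 2)) * Real.exp (K₈ * E) := by
    have e : S.phi (-(lam t).ver) (S.rootProj α ((lam t₀).hor - (lam s).hor)) =
        S.phi ((lam s).ver - (lam t).ver)
          (S.phi (-(lam s).ver) (S.rootProj α ((lam t₀).hor - (lam s).hor))) := by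
      rw [← S.phi_add_apply]; congr 2; abel
    rw [e]
    refine (hphi α hα _ (S.phi_mem_rootSpace _ (S.rootProj_mem α _)) _).trans ?_
    have h1 := hdisp L lam f σ E η C₁ hq hf hw hη3 α hα hσ s hs t₀ ht₀ hbelow
    have h2 : α ((lam s).ver - (lam t).ver) ≤ R * E :=
      (apply_le_dualNorm α _).trans (mul_le_mul hRα' hver (norm_nonneg _) (by linarith))
    calc _ ≤ K₂ * (1 + E) ^ n₂ * Real.exp (R * E) *
          (Real.exp (K₃ * E) * (1 + S.slack lam η C₁ s) ^ m) := by gcongr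
      _ ≤ K₂ * (P₃ * Real.exp (1 * E)) * Real.exp (R * E) *
          (Real.exp (K₃ * E) * (P₂ * Real.exp (c / 6 * S.slack lam η C₁ s))) := by
          gcongr
          · exact hpow₃ E (by linarith)
          · exact hpow₂ _ hBs0
      _ = K₂ * P₂ * P₃ * Real.exp (c / 6 * S.slack lam η C₁ s) *
          (Real.exp (1 * E) * Real.exp (R * E) * Real.exp (K₃ * E)) := by ring
      _ = K₂ * P₂ * P₃ * Real.exp (c / 6 * S.slack lam η C₁ s) * Real.exp (K₈ * E) := by
          rw [← Real.exp_add, ← Real.exp_add, hK₈, add_mul, add_mul]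
      _ ≤ _ := by
          refine mul_le_mul_of_nonneg_right (mul_le_mul_of_nonneg_left (Real.exp_le_exp.2 ?_)
            (by positivity)) (Real.exp_pos _).le
          have e1 : c / 6 * S.slack lam η C₁ s ≤ dualNorm α / 6 * (3 * B) := by gcongr
          have e2 : 0 ≤ dualNorm α * (ω * B) := by positivity
          linarith
  have hsum : S.phi (-(lam t).ver) (S.rootProj α ((lam t₀).hor - (lam t).hor)) =
      S.phi (-(lam t).ver) (S.rootProj α ((lam s).hor - (lam t).hor)) +
        S.phi (-(lam t).ver) (S.rootProj α ((lam t₀).hor - (lam s).hor)) := by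
    rw [← map_add, ← map_add]; congr 2; abel
  rw [hsum]
  refine (norm_add_le _ _).trans ((add_le_add hfirst hsecond).trans ?_)
  have h7 : K₇ ≤ Real.exp (K₇ * E) := by
    have h2 := Real.add_one_le_exp (K₇ * E)
    have h3 : K₇ * 1 ≤ K₇ * E := by gcongr
    linarith
  calc _ = K₇ * Real.exp (dualNorm α * ((1 + ω) * B / 2)) * Real.exp (K₈ * E) := by rw [hK₇]; ring
    _ ≤ Real.exp (K₇ * E) * Real.exp (dualNorm α * ((1 + ω) * B / 2)) * Real.exp (K₈ * E) := by
        gcongr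
    _ = Real.exp (dualNorm α * ((1 + ω) * B / 2) + (K₇ + K₈) * E) := by
        rw [← Real.exp_add, ← Real.exp_add]; congr 1; ring
    _ ≤ _ := by
        rw [mul_add]
        refine Real.exp_le_exp.2 (add_le_add le_rfl ?_)
        calc (K₇ + K₈) * E = c * ((K₇ + K₈) / c * E) := by field_simp
          _ ≤ dualNorm α * (K * E) := by gcongr; linarith

theorem exists_displacement_le (S : SplitAbelianByAbelian H A) {κ C ω : ℝ}
    (hκ : 1 ≤ κ) (hC : 0 ≤ C) (hω : 0 < ω) (hω1 : ω ≤ 1) :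
    ∃ K : ℝ, 1 ≤ K ∧ ∀ (L : ℝ) (lam : ℝ → S.Point) (f : ℝ → ℝ)
      (σ : Module.Dual ℝ A → ℝ) (E η C₁ : ℝ), 0 ≤ L → S.IsQuasiGeodesic κ C L lam →
      S.FollowsLine lam L f σ E → S.WeaklyMonotoneAlong lam L f η C₁ → K * η ≤ 1 →
      ∀ α ∈ S.roots, ∃ t₀ ∈ Icc 0 L, ∀ t ∈ Icc 0 L,
        ‖S.phi (-(lam t).ver) (S.rootProj α ((lam t₀).hor - (lam t).hor))‖ ≤
          Real.exp (dualNorm α * ((1 + ω) * S.slack lam η C₁ t / 2 + K * E)) := by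
  obtain ⟨K, hK, h⟩ := S.exists_displacement_le_of_slope_nonneg hκ hC hω hω1
  refine ⟨K, hK, fun L lam f σ E η C₁ hL hq hf hw hη α hα => ?_⟩
  rcases le_total 0 (σ α) with hσ | hσ
  · exact h L lam f σ E η C₁ hL hq hf hw hη α hα hσ
  -- A decreasing root increases along the line run through in the opposite direction.
  · exact h L lam (-f) (-σ) E η C₁ hL hq hf.neg hw.neg hη α hα (by simpa using hσ)

/-- A weakly monotone quasi-geodesic following a line stays close to a single left coset of `A`.
The gain `1 - ω` over one slack per root leaves room for all lower order errors. -/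
theorem exists_horizontal_coordinate (S : SplitAbelianByAbelian H A) {κ C : ℝ}
    (hκ : 1 ≤ κ) (hC : 0 ≤ C) (hS : S.roots.Nonempty) :
    ∃ ω K : ℝ, 0 < ω ∧ ω < 1 ∧ 1 ≤ K ∧ ∀ (L : ℝ) (lam : ℝ → S.Point) (f : ℝ → ℝ)
      (σ : Module.Dual ℝ A → ℝ) (E η C₁ : ℝ), 0 ≤ L → S.IsQuasiGeodesic κ C L lam →
      S.FollowsLine lam L f σ E → S.WeaklyMonotoneAlong lam L f η C₁ → K * η ≤ 1 →
      ∃ y : H, ∀ t ∈ Icc 0 L, ∃ w : A,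
        S.rdist (lam t) ⟨y, w⟩ ≤ S.roots.card * (1 - ω) * S.slack lam η C₁ t + K * E ∧
        (w = (lam t).ver ∨ ∃ e : A, ‖e‖ = 1 ∧ ∀ z, ∃ c : ℝ, z = c • e) := by
  obtain ⟨ω, K₀, hω, hω1, hK₀, htrans⟩ := S.exists_rdist_translate_le hS
  obtain ⟨K₁, hK₁, hdisp⟩ := S.exists_displacement_le hκ hC hω hω1.le
  set N : ℝ := (S.roots.card : ℝ) with hN
  have hN0 : 0 ≤ N := Nat.cast_nonneg _
  have hK0 : 0 ≤ N * (2 * K₁) := by positivity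
  set K := K₁ + N * (2 * K₁) + K₀ with hK
  refine ⟨ω ^ 2, K, by positivity, by nlinarith, by linarith,
    fun L lam f σ E η C₁ hL hq hf hw hη => ?_⟩
  have hη' : K₁ * η ≤ 1 := (mul_le_mul_of_nonneg_right (by linarith) hw.eta_nonneg).trans hη
  have hE := hf.one_le
  have h1 : ∀ α : Module.Dual ℝ A, ∃ t₀ : ℝ, α ∈ S.roots → ∀ t ∈ Icc 0 L,
      ‖S.phi (-(lam t).ver) (S.rootProj α ((lam t₀).hor - (lam t).hor))‖ ≤
        Real.exp (dualNorm α * ((1 + ω) * S.slack lam η C₁ t / 2 + K₁ * E)) := by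
    intro α
    by_cases hα : α ∈ S.roots
    · obtain ⟨t₀, -, h⟩ := hdisp L lam f σ E η C₁ hL hq hf hw hη' α hα
      exact ⟨t₀, fun _ => h⟩
    · exact ⟨0, fun h => absurd h hα⟩
  choose t₀ ht₀ using h1
  refine ⟨∑ β ∈ S.roots, S.rootProj β (lam (t₀ β)).hor, fun t ht => ?_⟩
  set y := ∑ β ∈ S.roots, S.rootProj β (lam (t₀ β)).hor with hy
  have hyα : ∀ α ∈ S.roots, S.rootProj α y = S.rootProj α (lam (t₀ α)).hor := by
    intro α hα
    rw [hy, map_sum, Finset.sum_eq_single_of_mem α hα fun β hβ hne =>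
      S.rootProj_of_mem_of_ne hα hβ hne.symm (S.rootProj_mem β _)]
    exact S.rootProj_of_mem (S.rootProj_mem α _)
  have hB0 := hw.slack_nonneg t
  obtain ⟨w, hwd, hw'⟩ := htrans (lam t).hor y (lam t).ver
    ((1 + ω) * S.slack lam η C₁ t / 2 + K₁ * E) (by positivity) fun α hα => by
      rw [map_sub, hyα α hα, ← map_sub]
      exact ht₀ α hα t ht
  refine ⟨w, hwd.trans ?_, hw'⟩
  have h2 : N * (1 - ω) * (2 * (K₁ * E)) ≤ N * 1 * (2 * (K₁ * E)) := by gcongr; linarith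
  have h3 : K₀ * 1 ≤ K₀ * E := by gcongr
  have h4 : 0 ≤ K₁ * E := by positivity
  rw [hK]
  linarith

/-- How the gain `ω` removes the distance `d` to `λ(0)` from the bound: here `y` is the distance of
`λ(t)` from a point of the segment, `Y` the distance of this point from the base point `x₀`, and
`e` the lower order error. -/
theorem le_of_le_slack {y Y d N η ω C₁ h e : ℝ} (hN : 0 ≤ N) (hη : 0 ≤ η) (hω : 0 < ω)
    (hω1 : ω < 1) (hC₁ : 0 ≤ C₁) (hh : 0 ≤ h) (hY : 0 ≤ Y) (hηω : N * η ≤ ω / 4)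
    (he : e ≤ N * h / 2) (hy : y ≤ N * (1 - ω) * (η * d + C₁) + e)
    (hd : d ≤ y + Y + N * (h + C₁)) : y ≤ N * η * Y + N * (h + C₁) := by
  set μ := (1 - ω) * (N * η) with hμ
  have hNη : 0 ≤ N * η := mul_nonneg hN hη
  have hμ0 : 0 ≤ μ := mul_nonneg (by linarith) hNη
  have hμω : μ ≤ ω / 4 := by
    have : μ ≤ 1 * (N * η) := by rw [hμ]; gcongr; linarith
    linarith
  have h1 : μ * d ≤ μ * (y + Y + N * (h + C₁)) := by gcongr
  have h2 : y ≤ μ * d + N * (1 - ω) * C₁ + e := by rw [hμ]; linarith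
  have hc0 : 0 ≤ N * C₁ := by positivity
  have hh0 : 0 ≤ N * h := by positivity
  have h3 : (1 - μ) * y ≤ (1 - μ) * (N * η * Y + N * (h + C₁)) := by
    have a1 : μ * (N * η * Y) ≤ ω / 4 * (N * η * Y) := by gcongr
    have a2 : μ * Y = (1 - ω) * (N * η * Y) := by rw [hμ]; ring
    have a3 : μ * (N * C₁) ≤ ω / 4 * (N * C₁) := by gcongr
    have a4 : μ * (N * h) ≤ 1 / 4 * (N * h) := by gcongr; linarith
    have a5 : 0 ≤ ω * (N * η * Y) := by positivity
    have a6 : 0 ≤ ω * (N * C₁) := by positivity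
    linarith
  exact le_of_mul_le_mul_left h3 (by linarith)

end SplitAbelianByAbelian

namespace SplitAbelianByAbelian

variable {H A : Type*} [NormedAddCommGroup H] [InnerProductSpace ℝ H] [FiniteDimensional ℝ H]
  [NormedAddCommGroup A] [InnerProductSpace ℝ A] [FiniteDimensional ℝ A]

/-! ### Straight segments near monotone quasi-geodesics -/

theorem add_mul_le_sqrt_mul {δ ε K ℓ : ℝ} (hK : 0 ≤ K) (hℓ : 0 ≤ ℓ) :
    K * ((δ + ε) * (ℓ + 1)) ≤ 2 * K * (Real.sqrt (δ ^ 2 + 4 * ε ^ 2) * (ℓ + 1)) := by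
  have h1 : (δ + ε) / 2 ≤ Real.sqrt (δ ^ 2 + 4 * ε ^ 2) :=
    Real.le_sqrt_of_sq_le (by nlinarith [sq_nonneg (δ - ε)])
  calc K * ((δ + ε) * (ℓ + 1)) = 2 * K * ((δ + ε) / 2 * (ℓ + 1)) := by ring
    _ ≤ _ := by gcongr

/-- Monotone quasi-geodesics are weakly monotone with `η = 0` and `C₁ = δ D`. Their Hausdorff
distance from a straight segment is `O(δ D + (δ + ε) (|ab| + 1))`. -/
theorem exists_hausdorffWithin_of_isMonotone (S : SplitAbelianByAbelian H A) {κ C : ℝ}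
    (hκ : 1 ≤ κ) (hC : 0 ≤ C) (hS : S.roots.Nonempty) :
    ∃ K₀ : ℝ, ∀ hbar, K₀ ≤ hbar → ∀ (L : ℝ) (lam : ℝ → S.Point) (ε δ : ℝ) (a b : A), 0 ≤ L →
      S.IsQuasiGeodesic κ C L lam → 0 < δ → 3 ≤ δ * S.rdist (lam 0) (lam L) →
      (lam L).ver ∉ linearNbhd dist (Point.ver '' S.walls (lam 0)) (lam 0).ver
        (3 / (δ * S.rdist (lam 0) (lam L))) C →
      S.IsMonotone hbar ε δ L a b lam →
      ∃ (p : S.Point) (a' b' : A),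
        HausdorffWithin S.rdist
          (2 * S.roots.card * (hbar * Real.sqrt (δ ^ 2 + 4 * ε ^ 2) * (dist a b + 1)
            + δ * S.rdist (lam 0) (lam L)))
          (lam '' Icc 0 L) (S.geodSegment p a' b') ∧
        HausdorffWithin S.rdist (hbar * δ * (L + 1))
          (lam '' Icc 0 L) (S.geodSegment p a' b') := by
  obtain ⟨K, hK, hfollow⟩ := S.exists_followsLine hκ hC
  obtain ⟨ω, M, hω, hω1, hM, hcoord⟩ := S.exists_horizontal_coordinate hκ hC hS
  set N : ℝ := (S.roots.card : ℝ) with hN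
  have hN1 : 1 ≤ N := Nat.one_le_cast.2 hS.card_pos
  have p3 : 0 ≤ 2 * N * (κ + C) := by positivity
  have p4 : 0 ≤ (2 * M + 1) * (2 * K ^ 2) := by positivity
  have p5 : 0 ≤ (2 * M + 1) * K := by positivity
  refine ⟨2 + 2 * N * (κ + C) + (2 * M + 1) * (2 * K ^ 2) + (2 * M + 1) * K,
    fun hbar hhbar L lam ε δ a b hL hq hδ hD hwall => ?_⟩
  rintro ⟨hnear, hεδ, hδ1, hmono⟩
  have hmem0 : (0 : ℝ) ∈ Icc 0 L := left_mem_Icc.2 hL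
  have hε0 : 0 ≤ ε := hnear.1
  have hε4 : 4 * ε ≤ δ := by
    linarith [mul_le_mul_of_nonneg_right (show 2 ≤ hbar by linarith) hε0]
  obtain ⟨f, σ, hf, hproj, hto, hfrom, -, hℓL⟩ :=
    hfollow L lam ε δ a b hL hq hδ (by linarith) hD hwall hnear
  set D := S.rdist (lam 0) (lam L) with hDdef
  have hD0 : 0 ≤ D := S.rdist_nonneg _ _
  have hDL : D ≤ (κ + C) * (L + 1) := by
    have := hq.rdist_le hmem0 (right_mem_Icc.2 hL)
    rw [zero_sub, abs_neg, abs_of_nonneg hL] at this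
    linarith [mul_nonneg hC hL]
  set ℓ := dist a b with hℓ
  have hℓ0 : 0 ≤ ℓ := dist_nonneg
  have hEr := add_mul_le_sqrt_mul (δ := δ) (ε := ε) (by linarith : 0 ≤ K) hℓ0
  set r := Real.sqrt (δ ^ 2 + 4 * ε ^ 2) with hr
  have hr0 : 0 ≤ r := Real.sqrt_nonneg _
  set E := K * ((δ + ε) * (ℓ + 1)) with hE
  have hE0 : 0 ≤ E := by positivity
  have hrℓ : 0 ≤ r * (ℓ + 1) := by positivity
  have hX0 : 0 ≤ δ * D := by positivity
  have hw : S.WeaklyMonotoneAlong lam L f 0 (δ * D) := by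
    refine ⟨le_rfl, hX0, fun s hs t ht _ hst => ?_⟩
    simpa [slack] using hmono t ht s hs (hproj t s hst)
  obtain ⟨y, hy⟩ := hcoord L lam f σ E 0 (δ * D) hL hq hf hw (by simp)
  have hEδ : E ≤ 2 * K ^ 2 * (δ * (L + 1)) := by
    calc E ≤ K * ((2 * δ) * (K * (L + 1))) := by rw [hE]; gcongr; linarith
      _ = _ := by ring
  -- Returning to the height of `λ(t)` at most doubles the distance to the coset.
  have hclose : ∀ t ∈ Icc 0 L, ∀ z : A, ‖(lam t).ver - z‖ ≤ E →
      S.rdist (lam t) ⟨y, z⟩ ≤ 2 * N * (δ * D) + (2 * M + 1) * E := by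
    intro t ht z hz
    obtain ⟨w, hw1, -⟩ := hy t ht
    have h1 : S.rdist ⟨y, w⟩ ⟨y, (lam t).ver⟩ ≤ S.rdist (lam t) ⟨y, w⟩ :=
      (S.rdist_ver_le y w _).trans (by
        rw [norm_sub_rev]; exact S.norm_ver_sub_le_rdist (lam t) ⟨y, w⟩)
    have h2 := S.rdist_ver_le y (lam t).ver z
    rw [norm_sub_rev] at h2
    have h3 := S.rdist_triangle (lam t) ⟨y, w⟩ ⟨y, (lam t).ver⟩
    have h4 := S.rdist_triangle (lam t) ⟨y, (lam t).ver⟩ ⟨y, z⟩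
    have h5 : S.slack lam 0 (δ * D) t = δ * D := by simp [slack]
    rw [h5] at hw1
    have h6 : N * (1 - ω) * (δ * D) ≤ N * 1 * (δ * D) := by gcongr; linarith
    linarith
  have hW : ∀ ρ, 2 * N * (δ * D) + (2 * M + 1) * E ≤ ρ →
      HausdorffWithin S.rdist ρ (lam '' Icc 0 L) (S.geodSegment ⟨y, 0⟩ a b) := by
    intro ρ hρ
    constructor
    · rintro _ ⟨t, ht, rfl⟩
      obtain ⟨z, hz, hzt⟩ := hto t ht
      exact ⟨⟨y, z⟩, (S.mk_mem_geodSegment y).2 hz, (hclose t ht z hzt).trans hρ⟩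
    · intro q hq
      obtain ⟨z, hz, rfl⟩ := S.exists_eq_of_mem_geodSegment hq
      obtain ⟨t, ht, hzt⟩ := hfrom z hz
      exact ⟨lam t, mem_image_of_mem lam ht, (hclose t ht z hzt).trans hρ⟩
  refine ⟨⟨y, 0⟩, a, b, hW _ ?_, hW _ ?_⟩
  · have h1 : (2 * M + 1) * E ≤ (2 * M + 1) * (2 * K * (r * (ℓ + 1))) :=
      mul_le_mul_of_nonneg_left hEr (by linarith)
    have h2 : (2 * M + 1) * K ≤ N * hbar := by
      have : 1 * hbar ≤ N * hbar := mul_le_mul_of_nonneg_right hN1 (by linarith)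
      linarith
    have h3 := mul_le_mul_of_nonneg_right h2 hrℓ
    linarith
  · have h1 : (2 * M + 1) * E ≤ (2 * M + 1) * (2 * K ^ 2 * (δ * (L + 1))) :=
      mul_le_mul_of_nonneg_left hEδ (by linarith)
    have h2 : 2 * N * (δ * D) ≤ 2 * N * (κ + C) * (δ * (L + 1)) := by
      calc 2 * N * (δ * D) ≤ 2 * N * (δ * ((κ + C) * (L + 1))) := by gcongr
        _ = _ := by ring
    have h3 : (2 * N * (κ + C) + (2 * M + 1) * (2 * K ^ 2)) * (δ * (L + 1)) ≤
        hbar * (δ * (L + 1)) := mul_le_mul_of_nonneg_right (by linarith) (by positivity)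
    linarith

/-- The points of a coset of `A` near which the path passes lie in one straight segment: if `A` is
a line, a long segment will do, and otherwise they may be taken at the height of the path, hence
in `[a, b]` up to an error `E`. -/
theorem exists_segment_of_horizontal_coordinate (S : SplitAbelianByAbelian H A)
    {κ C L η C₁ E M m : ℝ} {lam : ℝ → S.Point} {f : ℝ → ℝ} {a b : A} (hκ : 1 ≤ κ)
    (hm : 0 ≤ m) (hE : 0 ≤ E) (hL : 0 ≤ L) (hq : S.IsQuasiGeodesic κ C L lam)
    (hw : S.WeaklyMonotoneAlong lam L f η C₁)
    (hto : ∀ t ∈ Icc 0 L, ∃ z ∈ segment ℝ a b, ‖(lam t).ver - z‖ ≤ E) {y : H}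
    (hy : ∀ t ∈ Icc 0 L, ∃ w : A, S.rdist (lam t) ⟨y, w⟩ ≤ m * S.slack lam η C₁ t + M * E ∧
      (w = (lam t).ver ∨ ∃ e : A, ‖e‖ = 1 ∧ ∀ z, ∃ c : ℝ, z = c • e)) :
    ∃ a' b' : A, ∀ t ∈ Icc 0 L, ∃ z ∈ segment ℝ a' b',
      S.rdist (lam t) ⟨y, z⟩ ≤ m * S.slack lam η C₁ t + (M + 1) * E := by
  by_cases hline : ∃ e : A, ‖e‖ = 1 ∧ ∀ z, ∃ c : ℝ, z = c • e
  · obtain ⟨e, he, hline⟩ := hline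
    obtain ⟨X, hX⟩ := (isCompact_Icc.image_of_continuousOn hq.2.1).isBounded.exists_norm_le
    set T := X + (m * (η * (κ * L + C) + C₁) + M * E) with hT
    refine ⟨(-T) • e, T • e, fun t ht => ?_⟩
    obtain ⟨w, hw1, -⟩ := hy t ht
    obtain ⟨c, rfl⟩ := hline w
    refine ⟨c • e, ?_, hw1.trans (by linarith)⟩
    have h1 : ‖c • e - (lam t).ver‖ ≤ _ := S.norm_ver_sub_le_rdist (lam t) ⟨y, c • e⟩
    have h2 : ‖(lam t).ver‖ ≤ X := hX _ (mem_image_of_mem _ ht)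
    have h3 : S.slack lam η C₁ t ≤ η * (κ * L + C) + C₁ := by
      have h4 := hq.rdist_le ht (left_mem_Icc.2 hL)
      rw [sub_zero, abs_of_nonneg ht.1] at h4
      have h5 : κ * t ≤ κ * L := mul_le_mul_of_nonneg_left ht.2 (by linarith)
      exact add_le_add (mul_le_mul_of_nonneg_left (by linarith) hw.eta_nonneg) le_rfl
    have h4 := mul_le_mul_of_nonneg_left h3 hm
    have h5 : |c| ≤ T := by
      have h6 : ‖c • e‖ = |c| := by rw [norm_smul, he, mul_one, Real.norm_eq_abs]
      have h7 := norm_add_le (c • e - (lam t).ver) (lam t).ver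
      rw [sub_add_cancel, h6] at h7
      linarith
    have h6 := image_segment ℝ (LinearMap.toSpanSingleton ℝ A e).toAffineMap (-T) T
    simp only [LinearMap.coe_toAffineMap, LinearMap.toSpanSingleton_apply] at h6
    rw [← h6, segment_eq_Icc (by linarith [abs_nonneg c])]
    exact ⟨c, abs_le.1 h5, rfl⟩
  · refine ⟨a, b, fun t ht => ?_⟩
    obtain ⟨w, hw1, hw2⟩ := hy t ht
    obtain rfl := hw2.resolve_right hline
    obtain ⟨z, hz, hzt⟩ := hto t ht
    refine ⟨z, hz, ?_⟩
    have h1 := S.rdist_ver_le y (lam t).ver z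
    rw [norm_sub_rev] at h1
    linarith [S.rdist_triangle (lam t) ⟨y, (lam t).ver⟩ ⟨y, z⟩]

/-- The base point `x₀` is the point of the segment near `λ(0)`, where the slack is `C₁`. -/
theorem exists_linearNbhd_of_isWeaklyMonotone (S : SplitAbelianByAbelian H A) {κ C : ℝ}
    (hκ : 1 ≤ κ) (hC : 0 ≤ C) (hS : S.roots.Nonempty) :
    ∃ K₀ : ℝ, ∀ hbar, K₀ ≤ hbar → ∀ (L : ℝ) (lam : ℝ → S.Point) (ε δ : ℝ) (a b : A), 0 ≤ L →
      S.IsQuasiGeodesic κ C L lam → 0 < δ → 3 ≤ δ * S.rdist (lam 0) (lam L) →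
      (lam L).ver ∉ linearNbhd dist (Point.ver '' S.walls (lam 0)) (lam 0).ver
        (3 / (δ * S.rdist (lam 0) (lam L))) C →
      ∀ η C₁ : ℝ, 0 ≤ C₁ → hbar * η ≤ 1 → S.IsWeaklyMonotone κ hbar ε η C₁ L a b lam →
      ∃ (p : S.Point) (a' b' : A), ∃ x₀ ∈ S.geodSegment p a' b',
        S.rdist (lam 0) x₀ ≤ S.roots.card *
          (hbar * Real.sqrt (δ ^ 2 + 4 * ε ^ 2) * (dist a b + 1) + C₁) ∧
        lam '' Icc 0 L ⊆
          linearNbhd S.rdist (S.geodSegment p a' b') x₀ (S.roots.card * η)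
            (S.roots.card *
              (hbar * Real.sqrt (δ ^ 2 + 4 * ε ^ 2) * (dist a b + 1) + C₁)) := by
  obtain ⟨K, hK, hfollow⟩ := S.exists_followsLine hκ hC
  obtain ⟨ω, M, hω, hω1, hM, hcoord⟩ := S.exists_horizontal_coordinate hκ hC hS
  set N : ℝ := (S.roots.card : ℝ) with hN
  have hN1 : 1 ≤ N := Nat.one_le_cast.2 hS.card_pos
  have p1 : 0 ≤ 4 * N / ω := by positivity
  have p2 : 0 ≤ 4 * (M + 1) * K := by positivity
  refine ⟨1 + M + 4 * N / ω + 4 * (M + 1) * K,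
    fun hbar hhbar L lam ε δ a b hL hq hδ hD hwall η C₁ hC₁ hη => ?_⟩
  rintro ⟨hnear, hεη, hη1, hmono⟩
  have hmem0 : (0 : ℝ) ∈ Icc 0 L := left_mem_Icc.2 hL
  have hbar1 : 1 ≤ hbar := by linarith
  have hε0 : 0 ≤ ε := hnear.1
  have hε4 : 8 * ε ≤ η := by
    have hκ4 : 4 ≤ (2 * κ) ^ 2 := by nlinarith
    have h1 : 2 * ε * 1 * 4 ≤ 2 * ε * hbar * (2 * κ) ^ 2 := by gcongr
    linarith
  have hη0 : 0 ≤ η := by linarith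
  obtain ⟨f, σ, hf, hproj, hto, -, -, -⟩ :=
    hfollow L lam ε δ a b hL hq hδ (by linarith) hD hwall hnear
  set ℓ := dist a b with hℓ
  have hℓ0 : 0 ≤ ℓ := dist_nonneg
  have hEr := add_mul_le_sqrt_mul (δ := δ) (ε := ε) (by linarith : 0 ≤ K) hℓ0
  set r := Real.sqrt (δ ^ 2 + 4 * ε ^ 2) with hr
  have hr0 : 0 ≤ r := Real.sqrt_nonneg _
  set E := K * ((δ + ε) * (ℓ + 1)) with hE
  have hE0 : 0 ≤ E := by positivity
  have hrℓ : 0 ≤ r * (ℓ + 1) := by positivity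
  have hw : S.WeaklyMonotoneAlong lam L f η C₁ :=
    ⟨hη0, hC₁, fun s hs t ht hst hfst => hmono t ht s hs hst (hproj t s hfst)⟩
  obtain ⟨y, hy⟩ := hcoord L lam f σ E η C₁ hL hq hf hw
    ((mul_le_mul_of_nonneg_right (by linarith) hη0).trans hη)
  have hNω : 0 ≤ N * (1 - ω) := mul_nonneg (by linarith) (by linarith)
  obtain ⟨a', b', hseg⟩ :=
    S.exists_segment_of_horizontal_coordinate hκ hNω hE0 hL hq hw hto hy
  obtain ⟨z₀, hz₀, hx₀⟩ := hseg 0 hmem0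
  set h := hbar * r * (ℓ + 1) with hh
  have hh0 : 0 ≤ h := by positivity
  have hEh : (M + 1) * E ≤ N * h / 2 := by
    have h1 : (M + 1) * E ≤ (M + 1) * (2 * K * (r * (ℓ + 1))) :=
      mul_le_mul_of_nonneg_left hEr (by linarith)
    have h2 : 4 * (M + 1) * K * (r * (ℓ + 1)) ≤ hbar * (r * (ℓ + 1)) :=
      mul_le_mul_of_nonneg_right (by linarith) hrℓ
    have h3 : 1 * h ≤ N * h := mul_le_mul_of_nonneg_right hN1 hh0
    linarith
  have hx₀c : S.rdist (lam 0) ⟨y, z₀⟩ ≤ N * (h + C₁) := by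
    have h1 : S.slack lam η C₁ 0 = C₁ := by simp [slack, S.rdist_self]
    rw [h1] at hx₀
    have h2 : N * (1 - ω) * C₁ ≤ N * 1 * C₁ := by gcongr; linarith
    have h3 : 0 ≤ N * h := by positivity
    linarith
  refine ⟨⟨y, 0⟩, a', b', ⟨y, z₀⟩, (S.mk_mem_geodSegment y).2 hz₀, hx₀c, ?_⟩
  rintro _ ⟨t, ht, rfl⟩
  obtain ⟨z, hz, hzt⟩ := hseg t ht
  refine ⟨⟨y, z⟩, (S.mk_mem_geodSegment y).2 hz, ?_⟩
  have hηω : N * η ≤ ω / 4 := by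
    have h1 : 4 * N / ω * η ≤ 1 := (mul_le_mul_of_nonneg_right (by linarith) hη0).trans hη
    rw [div_mul_eq_mul_div, div_le_one hω] at h1
    linarith
  refine le_of_le_slack (by linarith) hη0 hω hω1 hC₁ hh0 (S.rdist_nonneg _ _) hηω hEh hzt ?_
  have h1 := S.rdist_triangle (lam t) ⟨y, z⟩ (lam 0)
  have h2 := S.rdist_triangle ⟨y, z⟩ ⟨y, z₀⟩ (lam 0)
  rw [S.rdist_comm ⟨y, z₀⟩ (lam 0)] at h2
  linarith

end SplitAbelianByAbelian

theorem mainTheorem5 {H A : Type*}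
    [NormedAddCommGroup H] [InnerProductSpace ℝ H] [FiniteDimensional ℝ H]
    [NormedAddCommGroup A] [InnerProductSpace ℝ A] [FiniteDimensional ℝ A]
    (S : SplitAbelianByAbelian H A) (κ C : ℝ) (hκ : 1 ≤ κ) (hC : 0 ≤ C) :
    ∃ hbar : ℝ, 1 ≤ hbar ∧
      ∀ (L : ℝ) (lam : ℝ → S.Point) (ε δ : ℝ) (a b : A) (t₀ : ℝ),
        0 ≤ L → S.IsQuasiGeodesic κ C L lam →
        0 < δ → δ < 1 → 3 ≤ δ * S.rdist (lam 0) (lam L) →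
        t₀ ∈ Set.Icc 0 L →
        (∀ t ∈ Set.Icc t₀ L, (lam t).ver ∉
          linearNbhd dist (SplitAbelianByAbelian.Point.ver '' S.walls (lam 0)) (lam 0).ver
            (3 / (δ * S.rdist (lam 0) (lam L))) C) →
        (S.IsMonotone hbar ε δ L a b lam →
          ∃ (p : S.Point) (a' b' : A),
            HausdorffWithin S.rdist
              (2 * S.roots.card * (hbar * Real.sqrt (δ ^ 2 + 4 * ε ^ 2) * (dist a b + 1)
                + δ * S.rdist (lam 0) (lam L)))
              (lam '' Set.Icc 0 L) (S.geodSegment p a' b') ∧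
            HausdorffWithin S.rdist (hbar * δ * (L + 1))
              (lam '' Set.Icc 0 L) (S.geodSegment p a' b')) ∧
        (∀ η C₁ : ℝ, 0 ≤ C₁ → hbar * η ≤ 1 →
          S.IsWeaklyMonotone κ hbar ε η C₁ L a b lam →
          ∃ (p : S.Point) (a' b' : A), ∃ x₀ ∈ S.geodSegment p a' b',
            S.rdist (lam 0) x₀ ≤ S.roots.card *
              (hbar * Real.sqrt (δ ^ 2 + 4 * ε ^ 2) * (dist a b + 1) + C₁) ∧
            lam '' Set.Icc 0 L ⊆
              linearNbhd S.rdist (S.geodSegment p a' b') x₀ (S.roots.card * η)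
                (S.roots.card *
                  (hbar * Real.sqrt (δ ^ 2 + 4 * ε ^ 2) * (dist a b + 1) + C₁))) := by
  rcases S.roots.eq_empty_or_nonempty with hS | hS
  · -- Without roots the group is trivial, and all distances vanish.
    refine ⟨1, le_rfl, fun L lam ε δ a b t₀ _ _ hδ _ hD _ _ => ?_⟩
    have hpos : 0 < S.rdist (lam 0) (lam L) := by
      by_contra h
      nlinarith
    exact absurd (S.roots_nonempty_of_rdist_pos hpos) (by simp [hS])
  obtain ⟨K₁, h₁⟩ := S.exists_hausdorffWithin_of_isMonotone hκ hC hS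
  obtain ⟨K₂, h₂⟩ := S.exists_linearNbhd_of_isWeaklyMonotone hκ hC hS
  refine ⟨max 1 (max K₁ K₂), le_max_left _ _,
    fun L lam ε δ a b t₀ hL hq hδ _ hD ht₀ hwall => ?_⟩
  have hwallL := hwall L (Set.right_mem_Icc.2 ht₀.2)
  exact ⟨h₁ _ ((le_max_left _ _).trans (le_max_right _ _)) L lam ε δ a b hL hq hδ hD hwallL,
    h₂ _ ((le_max_right _ _).trans (le_max_right _ _)) L lam ε δ a b hL hq hδ hD hwallL⟩
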